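/- Let $\dot H^1(\mathbb R^3)$ denote the space of $\phi\in L^6(\mathbb R^3;\mathbb C)$ whose weak gradient lies in $L^2$ (equivalently, the completion of $C_0^\infty(\mathbb R^3)$ for the norm $\|\nabla\phi\|_{L^2}$), and let $E(\phi,\psi)^2=\int_{\mathbb R^3}(|\nabla\phi|^2+|\psi|^2)\,dz$ be the energy of $(\phi,\psi)\in \dot H^1(\mathbb R^3)\times L^2(\mathbb R^3)$. For $\phi,\psi\in C_0^\infty(\mathbb R^3)$ let $u$ be the smooth solution of $(\partial_t^2-\Delta)u=0$ on $\mathbb R\times\mathbb R^3$ with $u(0,\cdot)=\phi$, $\partial_tu(0,\cdot)=\psi$, and let $$\mathcal R_+(\phi,\psi,0)(s,\theta)=\lim_{r\to\infty} r\,(\partial_tu)(s+r,r\theta),\qquad (s,\theta)\in\mathbb R\times\mathbb S^2,$$ be its forward radiation field. Denote also by $\mathcal R_+(\cdot,\cdot,0):\dot H^1(\mathbb R^3)\times L^2(\mathbb R^3)\to L^2(\mathbb R\times\mathbb S^2)$ the extension of this map by continuity with respect to the energy norm. Let $R\in\mathbb R$, let $F\in L^2(\mathbb R;\mathbb C)$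 be supported in $\{|s|\le R\}$, and suppose that $\int_{\mathbb R}F(s)\,ds=0$. Regard $F$ as a function on $\mathbb R\times\mathbb S^2$ that does not depend on $\theta$. Then there exist $(\phi,\psi)\in \dot H^1(\mathbb R^3)\times L^2(\mathbb R^3)$ with $\mathcal R_+(\phi,\psi,0)=F$ in $L^2(\mathbb R\times\mathbb S^2)$, and for every such pair $\phi$ and $\psi$ are radial functions with finite energy and $\phi(z)=\psi(z)=0$ for almost every $z$ with $|z|\ge R$. -/

import Mathlib

open MeasureTheory Filter Topology
open scoped ContDiff

noncomputable section

/-- Physical space `ℝ³` with its Euclidean norm. -/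
abbrev Space3 : Type := EuclideanSpace ℝ (Fin 3)

/-- The unit sphere `𝕊²`. -/
abbrev Sphere2 : Type := Metric.sphere (0 : Space3) 1

/-- Lebesgue measure times surface measure on the cylinder `ℝ × 𝕊²`. -/
def cylinderMeasure : Measure (ℝ × Sphere2) :=
  (volume : Measure ℝ).prod (volume : Measure Space3).toSphere

/-- `χ ∈ C₀^∞(ℝ³)`. -/
def IsTestFunction (χ : Space3 → ℂ) : Prop :=
  ContDiff ℝ ∞ χ ∧ HasCompactSupport χ

/-- The classical gradient `(∂₁φ, ∂₂φ, ∂₃φ)` of a complex valued function. -/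
def gradient3 (φ : Space3 → ℂ) (z : Space3) : EuclideanSpace ℂ (Fin 3) :=
  WithLp.toLp 2 fun i => fderiv ℝ φ z (EuclideanSpace.single i 1)

/-- `g` is the gradient of `φ` in the sense of distributions. -/
structure HasWeakGradient (φ : Space3 → ℂ) (g : Space3 → EuclideanSpace ℂ (Fin 3)) : Prop where
  locallyIntegrable : LocallyIntegrable φ volume
  locallyIntegrable_grad : LocallyIntegrable g volume
  integral_eq : ∀ χ : Space3 → ℂ, IsTestFunction χ → ∀ i : Fin 3,
    ∫ z, φ z * gradient3 χ z i = - ∫ z, g z i * χ z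

/-- `φ ∈ Ḣ¹(ℝ³)`: the weak gradient of `φ` is in `L²`. The condition `φ ∈ L⁶` selects, among the
functions that differ from `φ` by a constant, the one that lies in the completion of `C₀^∞(ℝ³)`
for the norm `‖∇φ‖_{L²}`. -/
def MemHomogeneousSobolev (φ : Space3 → ℂ) : Prop :=
  MemLp φ 6 volume ∧ ∃ g, HasWeakGradient φ g ∧ MemLp g 2 volume

/-- `(φ, ψ) ∈ Ḣ¹(ℝ³) × L²(ℝ³)`. -/
def FiniteEnergy (φ ψ : Space3 → ℂ) : Prop :=
  MemHomogeneousSobolev φ ∧ MemLp ψ 2 volume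

/-- `(φₙ, ψₙ) → (φ, ψ)` in the energy norm `E(φ, ψ)² = ∫ |∇φ|² + |ψ|²`, for differentiable `φₙ`
and data `(φ, ψ)` of finite energy. -/
def TendstoInEnergy (φn ψn : ℕ → Space3 → ℂ) (φ ψ : Space3 → ℂ) : Prop :=
  (∃ g, HasWeakGradient φ g ∧ MemLp g 2 volume ∧
    Tendsto (fun n => eLpNorm (fun z => gradient3 (φn n) z - g z) 2 volume) atTop (𝓝 0)) ∧
  Tendsto (fun n => eLpNorm (fun z => ψn n z - ψ z) 2 volume) atTop (𝓝 0)

/-- `u = u(t, z)` is a smooth solution of `(∂ₜ² - Δ) u = 0` on `ℝ × ℝ³` with Cauchy data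
`u(0, ·) = φ`, `∂ₜ u(0, ·) = ψ`. -/
structure IsWaveSolution (φ ψ : Space3 → ℂ) (u : ℝ × Space3 → ℂ) : Prop where
  contDiff : ContDiff ℝ ∞ u
  wave_eq : ∀ (t : ℝ) (z : Space3),
    iteratedDeriv 2 (fun τ : ℝ => u (τ, z)) t =
      Laplacian.laplacian (fun y : Space3 => u (t, y)) z
  initial_value : ∀ z, u (0, z) = φ z
  initial_velocity : ∀ z, deriv (fun τ : ℝ => u (τ, z)) 0 = ψ z

/-- `G = 𝓡₊(φ, ψ, 0)` for smooth data: `G(s, θ) = lim_{r → ∞} r (∂ₜ u)(s + r, r θ)` for the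
solution `u` of the wave equation with data `(φ, ψ)`. -/
def IsClassicalRadiationField (φ ψ : Space3 → ℂ) (G : ℝ × Sphere2 → ℂ) : Prop :=
  ∃ u : ℝ × Space3 → ℂ, IsWaveSolution φ ψ u ∧
    ∀ (s : ℝ) (θ : Sphere2),
      Tendsto (fun r : ℝ => (r : ℂ) * deriv (fun τ : ℝ => u (τ, r • (θ : Space3))) (s + r))
        atTop (𝓝 (G (s, θ)))

/-- `G = 𝓡₊(φ, ψ, 0)` in `L²(ℝ × 𝕊²)` for `(φ, ψ) ∈ Ḣ¹ × L²`, where `𝓡₊` is the extension by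
continuity, from `C₀^∞ × C₀^∞` to the energy space, of the classical radiation field: `G` is the
`L²` limit of the radiation fields of test data that converge to `(φ, ψ)` in energy. -/
def IsRadiationField (φ ψ : Space3 → ℂ) (G : ℝ × Sphere2 → ℂ) : Prop :=
  FiniteEnergy φ ψ ∧ MemLp G 2 cylinderMeasure ∧
  ∃ (φn ψn : ℕ → Space3 → ℂ) (Gn : ℕ → ℝ × Sphere2 → ℂ),
    (∀ n, IsTestFunction (φn n) ∧ IsTestFunction (ψn n)) ∧
    TendstoInEnergy φn ψn φ ψ ∧
    (∀ n, IsClassicalRadiationField (φn n) (ψn n) (Gn n)) ∧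
    Tendsto (fun n => eLpNorm (fun p => Gn n p - G p) 2 cylinderMeasure) atTop (𝓝 0)

/-- `f` agrees almost everywhere with a function of `|z|`. -/
def IsRadial (f : Space3 → ℂ) : Prop :=
  ∃ h : ℝ → ℂ, ∀ᵐ z, f z = h ‖z‖

end

open scoped ComplexConjugate

/-! The data are determined by the radiation field, and for a profile independent of `θ` they can be
written down. So existence comes from a formula plus a limit, and the radiality and support of an
arbitrary pair follow from uniqueness.

Formula: averaging the plane waves `K(t + z·θ)` over the sphere gives a smooth radial wave. By
Archimedes' formula, in the normalization of `radialWave`, `r u = g(t - r) - g(t + r)` with `g' =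
K`, hence `r ∂ₜu = K(t - r) - K(t + r)`. For compactly supported `K` the value at `t = s + r` is
exactly `K(s)` once `r` is large. At `t = 0` this gives `φ = (g(-r) - g(r))/r` and `ψ = (K(-r) -
K(r))/r`. Since `∫ K = 0`, the primitive `g` can be chosen with the same support bound as `K`, and
both data vanish outside the corresponding ball (`exists_radial_data`). A general `F` is an `L²`
limit of such profiles on slightly larger intervals (`exists_smooth_approx`).

Uniqueness: the key estimate is `IsSmoothWave.energy_le`, which bounds the energy of test data by
`2‖G‖²`. Darboux's equation yields Kirchhoff's formula, hence Huygens' principle and `1/t` decay, so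
the kinetic energy `∫|∂ₜu|²` tends to `‖G‖²`. The total energy `E` is conserved, and `d²/dt² ∫|u|² =
4 ∫|∂ₜu|² - 2E`. If `E > 2‖G‖²`, the right side would eventually stay below a negative constant and
force `∫|u|² < 0`.

The same estimate makes the approximating data Cauchy in energy, with the Sobolev inequality
supplying the limit of `φ` in `L⁶`. It also shows that two pairs with one field have equal `ψ` and
equal `∇φ`. An `L⁶` function with zero weak gradient vanishes (`ae_eq_zero_of_weak_deriv_eq_zero`),
so `φ` is unique as well. -/

/-- The surface measure of the unit sphere `𝕊²`. -/
noncomputable abbrev surf : Measure Sphere2 := (volume : Measure Space3).toSphere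

theorem Continuous.integrable_surf {F : Type*} [NormedAddCommGroup F] {f : Sphere2 → F}
    (hf : Continuous f) : Integrable f surf :=
  hf.integrable_of_hasCompactSupport (HasCompactSupport.of_compactSpace f)

/-! ### Smooth dependence of sphere integrals on parameters. -/

section SphereIntegral

variable {E F : Type} [NormedAddCommGroup E] [NormedSpace ℝ E] [FiniteDimensional ℝ E]
  [NormedAddCommGroup F] [NormedSpace ℝ F]

theorem hasFDerivAt_sphere_integral {f : E × Space3 → F} (hf : ContDiff ℝ 1 f) (x : E) :
    HasFDerivAt (fun x => ∫ θ : Sphere2, f (x, θ) ∂surf)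
      (∫ θ : Sphere2, (fderiv ℝ f (x, θ)).comp (ContinuousLinearMap.inl ℝ E Space3) ∂surf) x := by
  have hc0 : Continuous fun p : E × Sphere2 =>
      ‖(fderiv ℝ f (p.1, (p.2 : Space3))).comp (ContinuousLinearMap.inl ℝ E Space3)‖ := by
    have := hf.continuous_fderiv one_ne_zero
    fun_prop
  have hf0 := hf.continuous
  obtain ⟨M, hM⟩ := (((isCompact_closedBall x 1).prod (isCompact_univ (X := Sphere2))).bddAbove_image
    hc0.continuousOn)
  replace hM : ∀ y ∈ Metric.closedBall x 1, ∀ θ : Sphere2,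
      ‖(fderiv ℝ f (y, (θ : Space3))).comp (ContinuousLinearMap.inl ℝ E Space3)‖ ≤ M :=
    fun y hy θ => hM ⟨(y, θ), ⟨hy, Set.mem_univ θ⟩, rfl⟩
  refine hasFDerivAt_integral_of_dominated_of_fderiv_le (s := Metric.closedBall x 1)
    (bound := fun _ => M)
    (F' := fun x (θ : Sphere2) =>
      (fderiv ℝ f (x, (θ : Space3))).comp (ContinuousLinearMap.inl ℝ E Space3))
    (Metric.closedBall_mem_nhds x one_pos) (Eventually.of_forall fun y => ?_) ?_ ?_ ?_
    (integrable_const M) ?_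
  · exact Continuous.aestronglyMeasurable (by fun_prop)
  · exact Continuous.integrable_surf (by fun_prop)
  · have := hf.continuous_fderiv one_ne_zero
    exact Continuous.aestronglyMeasurable (by fun_prop)
  · exact Eventually.of_forall fun θ y hy => hM y hy θ
  · refine Eventually.of_forall fun θ y _ => ?_
    have h1 := ((hf.differentiable one_ne_zero) (y, (θ : Space3))).hasFDerivAt
    exact h1.comp y (hasFDerivAt_prodMk_left y (θ : Space3))

/-- Induction on the order. The target `F` is quantified inside because the derivative of the
integral is again a sphere integral, now with values in `E →L[ℝ] F`. -/
theorem contDiff_nat_sphere_integral (n : ℕ) : ∀ {F : Type} [NormedAddCommGroup F]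
    [NormedSpace ℝ F] {f : E × Space3 → F}, ContDiff ℝ ∞ f →
    ContDiff ℝ n (fun x => ∫ θ : Sphere2, f (x, θ) ∂surf) := by
  induction n with
  | zero =>
    intro F _ _ f hf
    have : Differentiable ℝ (fun x : E => ∫ θ : Sphere2, f (x, θ) ∂surf) := fun x =>
      (hasFDerivAt_sphere_integral (hf.of_le (by exact_mod_cast le_top)) x).differentiableAt
    exact contDiff_zero.2 this.continuous
  | succ n ih =>
    intro F _ _ f hf
    have hf1 : ContDiff ℝ 1 f := hf.of_le (by exact_mod_cast le_top)
    have h := hasFDerivAt_sphere_integral hf1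
    rw [Nat.cast_succ, contDiff_succ_iff_hasFDerivAt]
    refine ⟨_, ih (f := fun p =>
      (fderiv ℝ f p).comp (ContinuousLinearMap.inl ℝ E Space3)) ?_, h⟩
    exact (hf.fderiv_right (m := ∞) (by simp)).clm_comp contDiff_const

theorem contDiff_sphere_integral {f : E × Space3 → F} (hf : ContDiff ℝ ∞ f) :
    ContDiff ℝ ∞ (fun x => ∫ θ : Sphere2, f (x, θ) ∂surf) :=
  contDiff_infty.2 fun n => contDiff_nat_sphere_integral n hf

theorem fderiv_sphere_integral [CompleteSpace F] {f : E × Space3 → F} (hf : ContDiff ℝ ∞ f)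
    (x v : E) :
    fderiv ℝ (fun x => ∫ θ : Sphere2, f (x, θ) ∂surf) x v =
      ∫ θ : Sphere2, fderiv ℝ f (x, θ) (v, 0) ∂surf := by
  rw [(hasFDerivAt_sphere_integral (hf.of_le (by exact_mod_cast le_top)) x).fderiv,
    ContinuousLinearMap.integral_apply]
  · simp
  · have := hf.continuous_fderiv (by simp)
    exact Continuous.integrable_surf (by fun_prop)

end SphereIntegral

theorem hasDerivAt_sphere_integral {f : ℝ × Space3 → ℂ} (hf : ContDiff ℝ ∞ f) (x : ℝ) :
    HasDerivAt (fun x => ∫ θ : Sphere2, f (x, θ) ∂surf)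
      (∫ θ : Sphere2, fderiv ℝ f (x, θ) (1, 0) ∂surf) x := by
  have h := (((contDiff_sphere_integral hf).differentiable (by simp)) x).hasFDerivAt.hasDerivAt
  rwa [fderiv_sphere_integral hf] at h

/-! ### Polar coordinates. -/

theorem measurePreserving_polar : MeasurePreserving (homeomorphUnitSphereProd Space3)
    ((volume : Measure Space3).comap (↑)) (surf.prod (Measure.volumeIoiPow 2)) := by
  simpa using (volume : Measure Space3).measurePreserving_homeomorphUnitSphereProd

theorem integral_eq_integral_sphere {f : Space3 → ℂ} (hf : Integrable f volume) :
    ∫ z, f z = ∫ r in Set.Ioi (0 : ℝ), (r : ℂ) ^ 2 * ∫ θ : Sphere2, f (r • (θ : Space3)) ∂surf := by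
  have hme := Homeomorph.measurableEmbedding (homeomorphUnitSphereProd Space3)
  set g : Sphere2 × Set.Ioi (0 : ℝ) → ℂ := fun p => f (p.2.1 • (p.1 : Space3)) with hg
  have hcomp : ∀ x : ({0}ᶜ : Set Space3), g (homeomorphUnitSphereProd Space3 x) = f x := by
    intro x
    have hx : ‖(x : Space3)‖ ≠ 0 := norm_ne_zero_iff.2 x.2
    simp [hg, smul_smul, hx]
  have h1 : ∫ z, f z = ∫ x : ({0}ᶜ : Set Space3), f (x : Space3) ∂(Measure.comap Subtype.val volume) := by
    rw [integral_subtype_comap (measurableSet_singleton _).compl f, restrict_compl_singleton]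
  have h2 : Integrable g (surf.prod (Measure.volumeIoiPow 2)) := by
    rw [← measurePreserving_polar.integrable_comp_emb hme,
      show g ∘ homeomorphUnitSphereProd Space3 = f ∘ Subtype.val from funext hcomp,
      ← integrableOn_iff_comap_subtypeVal (measurableSet_singleton _).compl]
    exact hf.integrableOn
  rw [h1, ← integral_congr_ae (Eventually.of_forall hcomp),
    measurePreserving_polar.integral_comp hme, integral_prod_symm _ h2]
  simp only [Measure.volumeIoiPow, ENNReal.ofReal]
  rw [integral_withDensity_eq_integral_smul (by fun_prop),
    integral_subtype_comap measurableSet_Ioi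
      (fun a : ℝ => Real.toNNReal (a ^ 2) • ∫ θ : Sphere2, f (a • (θ : Space3)) ∂surf)]
  refine setIntegral_congr_fun measurableSet_Ioi fun r _ => ?_
  simp only [NNReal.smul_def, Real.coe_toNNReal _ (sq_nonneg r), Complex.real_smul]
  push_cast
  rfl

theorem lintegral_eq_lintegral_sphere {f : Space3 → ENNReal} (hf : Measurable f) :
    ∫⁻ z, f z = ∫⁻ θ : Sphere2, (∫⁻ r in Set.Ioi (0 : ℝ),
      ENNReal.ofReal (r ^ 2) * f (r • (θ : Space3))) ∂surf := by
  have hme := Homeomorph.measurableEmbedding (homeomorphUnitSphereProd Space3)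
  set g : Sphere2 × Set.Ioi (0 : ℝ) → ENNReal := fun p => f (p.2.1 • (p.1 : Space3)) with hg
  have hcomp : ∀ x : ({0}ᶜ : Set Space3), g (homeomorphUnitSphereProd Space3 x) = f x := by
    intro x
    have hx : ‖(x : Space3)‖ ≠ 0 := norm_ne_zero_iff.2 x.2
    simp [hg, smul_smul, hx]
  have hgm : Measurable g := by fun_prop
  have h1 : ∫⁻ z, f z = ∫⁻ x : ({0}ᶜ : Set Space3), f (x : Space3) ∂(Measure.comap Subtype.val volume) := by
    rw [lintegral_subtype_comap (measurableSet_singleton _).compl f, restrict_compl_singleton]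
  rw [h1, ← lintegral_congr hcomp,
    measurePreserving_polar.lintegral_comp_emb hme, lintegral_prod _ hgm.aemeasurable]
  refine lintegral_congr fun θ => ?_
  simp only [Measure.volumeIoiPow]
  rw [lintegral_withDensity_eq_lintegral_mul _ (by fun_prop) (by fun_prop)]
  exact lintegral_subtype_comap measurableSet_Ioi
      (fun a : ℝ => ENNReal.ofReal (a ^ 2) * f (a • (θ : Space3)))

/-! ### Directional derivatives and integration by parts. -/

/-- The directional derivative of `f` along the constant vector field `v`. -/
noncomputable def pd {V : Type*} [NormedAddCommGroup V] [NormedSpace ℝ V] (v : V) (f : V → ℂ)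
    (x : V) : ℂ :=
  fderiv ℝ f x v

/-- The standard basis vectors of `ℝ³`. -/
noncomputable abbrev basisVec (i : Fin 3) : Space3 := EuclideanSpace.single i (1 : ℝ)

section DirectionalDerivative

variable {V : Type*} [NormedAddCommGroup V] [NormedSpace ℝ V] {f : V → ℂ}

theorem ContDiff.pd (hf : ContDiff ℝ ∞ f) (v : V) : ContDiff ℝ ∞ (pd v f) :=
  (hf.fderiv_right (m := ∞) (by simp)).clm_apply contDiff_const

theorem pd_comm (hf : ContDiff ℝ ∞ f) (v w : V) : pd v (pd w f) = pd w (pd v f) := by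
  have hd : Differentiable ℝ (fderiv ℝ f) :=
    (hf.fderiv_right (m := ∞) (by simp)).differentiable (by simp)
  funext x
  have hsymm : IsSymmSndFDerivAt ℝ f x := hf.contDiffAt.isSymmSndFDerivAt (by
    
    simp only [minSmoothness_of_isRCLikeNormedField]
    exact (mod_cast le_top : ((2 : ℕ∞) : WithTop ℕ∞) ≤ ∞))
  have key : ∀ a b : V, pd a (pd b f) x = fderiv ℝ (fderiv ℝ f) x a b := by
    intro a b
    change fderiv ℝ (fun y => fderiv ℝ f y b) x a = _
    rw [fderiv_clm_apply (hd x) (differentiableAt_const b)]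
    simp
  rw [key, key, hsymm.eq]

theorem HasCompactSupport.pd (hf : HasCompactSupport f) (v : V) : HasCompactSupport (pd v f) :=
  hf.fderiv_apply ℝ v

theorem integral_mul_pd [MeasurableSpace V] [BorelSpace V] [FiniteDimensional ℝ V]
    {μ : Measure V} [μ.IsAddHaarMeasure] {g : V → ℂ}
    (hf : ContDiff ℝ ∞ f) (hg : ContDiff ℝ ∞ g) (hfs : HasCompactSupport f) (v : V) :
    ∫ x, f x * pd v g x ∂μ = - ∫ x, pd v f x * g x ∂μ := by
  refine integral_mul_fderiv_eq_neg_fderiv_mul_of_integrable ?_ ?_ ?_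
    (fun x _ => (hf.differentiable (by simp)) x) (fun x _ => (hg.differentiable (by simp)) x)
  · exact ((hf.pd v).continuous.mul hg.continuous).integrable_of_hasCompactSupport
      (HasCompactSupport.mul_right (hfs.pd v))
  · exact (hf.continuous.mul (hg.pd v).continuous).integrable_of_hasCompactSupport hfs.mul_right
  · exact (hf.continuous.mul hg.continuous).integrable_of_hasCompactSupport hfs.mul_right

end DirectionalDerivative

theorem sum_basisVec (y : Space3) : y = ∑ i, y i • basisVec i := by
  ext j
  simp [Finset.sum_apply, Pi.single_apply]

theorem fderiv_apply_eq_sum {f : Space3 → ℂ} (x y : Space3) :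
    fderiv ℝ f x y = ∑ i, (y i : ℂ) * pd (basisVec i) f x := by
  conv_lhs => rw [sum_basisVec y]
  rw [map_sum]
  simp [pd]

/-! ### Spherical means and Darboux's equation. -/

/-- The spherical means of `f`, not normalized. -/
noncomputable def sphereMean (f : Space3 → ℂ) (r : ℝ) : ℂ :=
  ∫ θ : Sphere2, f (r • (θ : Space3)) ∂surf

theorem contDiff_sphereMean {f : Space3 → ℂ} (hf : ContDiff ℝ ∞ f) :
    ContDiff ℝ ∞ (sphereMean f) :=
  contDiff_sphere_integral (f := fun p : ℝ × Space3 => f (p.1 • p.2))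
    (hf.comp (contDiff_fst.smul contDiff_snd))

theorem deriv_sphereMean {f : Space3 → ℂ} (hf : ContDiff ℝ ∞ f) (r : ℝ) :
    deriv (sphereMean f) r = ∫ θ : Sphere2, fderiv ℝ f (r • (θ : Space3)) θ ∂surf := by
  have h := (hasDerivAt_sphere_integral (f := fun p : ℝ × Space3 => f (p.1 • p.2))
    (hf.comp (contDiff_fst.smul contDiff_snd)) r).deriv
  refine h.trans (integral_congr_ae (Eventually.of_forall fun θ => ?_))
  have h1 := (hasFDerivAt_fst (𝕜 := ℝ) (p := (r, (θ : Space3)))).fun_smul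
    (hasFDerivAt_snd (𝕜 := ℝ) (p := (r, (θ : Space3))))
  have h2 := ((hf.differentiable (by simp)) (r • (θ : Space3))).hasFDerivAt.comp
    (r, (θ : Space3)) h1
  have h3 := h2.fderiv
  simp only [Function.comp_def] at h3
  simp [h3]

/-- The norm is smooth away from the origin, and `g` vanishes near `0`. -/
theorem contDiff_comp_norm {g : ℝ → ℝ} (hg : ContDiff ℝ ∞ g) (hs : tsupport g ⊆ Set.Ioi 0) :
    ContDiff ℝ ∞ (fun y : Space3 => ((g ‖y‖ : ℝ) : ℂ)) := by
  refine Complex.ofRealCLM.contDiff.comp (contDiff_iff_contDiffAt.2 fun y => ?_)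
  rcases eq_or_ne y 0 with rfl | hy
  · have h0 : g =ᶠ[𝓝 0] 0 := notMem_tsupport_iff_eventuallyEq.1 fun h => lt_irrefl (0 : ℝ) (hs h)
    have h1 : Tendsto (fun y : Space3 => ‖y‖) (𝓝 0) (𝓝 0) := by
      simpa using (continuous_norm (E := Space3)).tendsto 0
    have h2 : (fun y : Space3 => g ‖y‖) =ᶠ[𝓝 0] fun _ => 0 := h1.eventually h0
    exact contDiffAt_const.congr_of_eventuallyEq h2
  · exact hg.contDiffAt.comp y (contDiffAt_norm ℝ hy)

theorem pd_comp_norm {g : ℝ → ℝ} (hg : ContDiff ℝ ∞ g) (v : Space3) {y : Space3} (hy : y ≠ 0) :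
    pd v (fun y : Space3 => ((g ‖y‖ : ℝ) : ℂ)) y
      = ((deriv g ‖y‖ * (‖y‖⁻¹ * inner ℝ y v) : ℝ) : ℂ) := by
  have h1 : HasFDerivAt (fun y : Space3 => ‖y‖) (‖y‖⁻¹ • innerSL ℝ y) y := by
    have h := ((contDiffAt_norm (n := 1) ℝ hy).differentiableAt one_ne_zero).hasFDerivAt
    -- The derivative of the norm is read off from that of its square.
    have h' := (h.pow 2).unique (hasStrictFDerivAt_norm_sq y).hasFDerivAt
    have hn := norm_ne_zero_iff.2 hy
    suffices heq : ‖y‖⁻¹ • innerSL ℝ y = fderiv ℝ (fun y : Space3 => ‖y‖) y by rwa [heq]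
    refine ContinuousLinearMap.ext fun w => ?_
    have hw : 2 * ‖y‖ * fderiv ℝ (fun y : Space3 => ‖y‖) y w = 2 * inner ℝ y w := by
      simpa using DFunLike.congr_fun h' w
    change ‖y‖⁻¹ * inner ℝ y w = _
    field_simp
    linarith
  have h2 : HasDerivAt (fun r : ℝ => ((g r : ℝ) : ℂ)) ((deriv g ‖y‖ : ℝ) : ℂ) ‖y‖ :=
    (((hg.differentiable (by simp)) ‖y‖).hasDerivAt).ofReal_comp
  have h3 := (h2.hasFDerivAt.comp y h1).fderiv
  simp only [Function.comp_def] at h3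
  rw [pd, h3]
  simp
  ring

/-- Integrate `Δf` by parts against the radial test function `g(|y|)` and pass to polar coordinates:
only the radial derivative of `f` survives, and its sphere integral is the derivative of the mean.
-/
theorem weak_darboux {f : Space3 → ℂ} (hf : ContDiff ℝ ∞ f) {g : ℝ → ℝ} (hg : ContDiff ℝ ∞ g)
    (hgc : HasCompactSupport g) (hs : tsupport g ⊆ Set.Ioi 0) :
    ∫ r in Set.Ioi (0 : ℝ), (r : ℂ) ^ 2 *
        ((g r : ℂ) * sphereMean (fun y => ∑ i, pd (basisVec i) (pd (basisVec i) f) y) r) =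
      - ∫ r in Set.Ioi (0 : ℝ), (r : ℂ) ^ 2 * (((deriv g r : ℝ) : ℂ) * deriv (sphereMean f) r) := by
  set K : Space3 → ℂ := fun y => ((g ‖y‖ : ℝ) : ℂ) with hKdef
  have hK : ContDiff ℝ ∞ K := contDiff_comp_norm hg hs
  have hKc : HasCompactSupport K := by
    obtain ⟨b, hb⟩ := hgc.isCompact.isBounded.subset_closedBall 0
    refine HasCompactSupport.of_support_subset_isCompact (isCompact_closedBall (0 : Space3) b) ?_
    intro y hy
    have : g ‖y‖ ≠ 0 := by simpa [hKdef] using hy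
    simpa using hb (subset_tsupport g this)
  have hint : ∀ i, ∫ y, K y * pd (basisVec i) (pd (basisVec i) f) y =
      - ∫ y, pd (basisVec i) K y * pd (basisVec i) f y := fun i =>
    integral_mul_pd hK (hf.pd _) hKc _
  have hI1 : ∀ i, Integrable fun y => K y * pd (basisVec i) (pd (basisVec i) f) y := fun i =>
    (hK.continuous.mul ((hf.pd _).pd _).continuous).integrable_of_hasCompactSupport hKc.mul_right
  have hI2 : ∀ i, Integrable fun y => pd (basisVec i) K y * pd (basisVec i) f y := fun i =>
    ((hK.pd _).continuous.mul (hf.pd _).continuous).integrable_of_hasCompactSupport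
      (HasCompactSupport.mul_right (hKc.pd _))
  have hsum : ∫ y, ∑ i, K y * pd (basisVec i) (pd (basisVec i) f) y =
      - ∫ y, ∑ i, pd (basisVec i) K y * pd (basisVec i) f y := by
    rw [integral_finsetSum _ fun i _ => hI1 i, integral_finsetSum _ fun i _ => hI2 i,
      ← Finset.sum_neg_distrib]
    exact Finset.sum_congr rfl fun i _ => hint i
  rw [integral_eq_integral_sphere (integrable_finsetSum _ fun i _ => hI1 i),
    integral_eq_integral_sphere (integrable_finsetSum _ fun i _ => hI2 i)] at hsum
  have hnorm : ∀ r ∈ Set.Ioi (0 : ℝ), ∀ θ : Sphere2, ‖r • (θ : Space3)‖ = r := by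
    intro r hr θ
    rw [norm_smul, norm_eq_of_mem_sphere, mul_one, Real.norm_of_nonneg (le_of_lt hr)]
  convert hsum using 1
  · refine setIntegral_congr_fun measurableSet_Ioi fun r hr => ?_
    simp only [sphereMean]
    rw [← integral_const_mul]
    congr 2
    funext θ
    rw [Finset.mul_sum]
    refine Finset.sum_congr rfl fun i _ => ?_
    simp only [hKdef, hnorm r hr θ]
  · congr 1
    refine setIntegral_congr_fun measurableSet_Ioi fun r hr => ?_
    beta_reduce
    rw [deriv_sphereMean hf, ← integral_const_mul]
    congr 2
    funext θ
    have hr' : (0 : ℝ) < r := hr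
    have hne : r • (θ : Space3) ≠ 0 := norm_ne_zero_iff.1 (by rw [hnorm r hr θ]; exact hr'.ne')
    rw [fderiv_apply_eq_sum, Finset.mul_sum]
    refine Finset.sum_congr rfl fun i _ => ?_
    rw [hKdef, pd_comp_norm hg _ hne, hnorm r hr θ]
    rw [inner_smul_left, EuclideanSpace.inner_single_right]
    simp only [conj_trivial, one_mul]
    rw [← mul_assoc, ← mul_assoc r⁻¹, inv_mul_cancel₀ hr'.ne', one_mul]
    push_cast
    rfl

/-- Darboux's equation for spherical means in `ℝ³`. -/
theorem darboux {f : Space3 → ℂ} (hf : ContDiff ℝ ∞ f) {r : ℝ} (hr : 0 < r) :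
    2 * deriv (sphereMean f) r + r * deriv (deriv (sphereMean f)) r =
      r * sphereMean (fun y => ∑ i, pd (basisVec i) (pd (basisVec i) f) y) r := by
  set A := sphereMean (fun y => ∑ i, pd (basisVec i) (pd (basisVec i) f) y) with hA
  set B := deriv (sphereMean f) with hB
  have hAs : ContDiff ℝ ∞ A := contDiff_sphereMean
    (ContDiff.sum fun i _ => (hf.pd _).pd _)
  have hBs : ContDiff ℝ ∞ B := (contDiff_infty_iff_deriv.1 (contDiff_sphereMean hf)).2
  have hB's : ContDiff ℝ ∞ (deriv B) := (contDiff_infty_iff_deriv.1 hBs).2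
  set C : ℝ → ℂ := fun r => (r : ℂ) ^ 2 * B r with hC
  have hof : ContDiff ℝ ∞ (fun r : ℝ => (r : ℂ)) := Complex.ofRealCLM.contDiff
  have hCs : ContDiff ℝ ∞ C := (hof.pow 2).mul hBs
  have hC' : ∀ r, deriv C r = 2 * r * B r + (r : ℂ) ^ 2 * deriv B r := by
    intro r
    have h1 : HasDerivAt (fun r : ℝ => (r : ℂ)) 1 r := Complex.ofRealCLM.hasDerivAt
    have h2 := (h1.pow 2).mul ((hBs.differentiable (by simp)) r).hasDerivAt
    have h3 := h2.deriv
    simp only [hC]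
    refine Eq.trans (by rfl) (h3.trans ?_)
    simp
  set D : ℝ → ℂ := fun r => (r : ℂ) ^ 2 * A r - deriv C r with hD
  have hDc : Continuous D := by
    have := hAs.continuous
    have := hBs.continuous
    have := hB's.continuous
    simp only [hD, hC']
    fun_prop
  -- Darboux's equation times `r` reads `r² A = (r² B)'`. Its defect `D` is orthogonal to all test
  -- functions on the half-line, and `D` is continuous.
  have hae : ∀ᵐ r : ℝ, r ∈ Set.Ioi (0 : ℝ) → D r = 0 := by
    refine isOpen_Ioi.ae_eq_zero_of_integral_contDiff_smul_eq_zero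
      (hDc.locallyIntegrable.locallyIntegrableOn _) fun g hg hgc hs => ?_
    have hz : ∀ r ∉ Set.Ioi (0 : ℝ), g r = 0 := fun r hr =>
      image_eq_zero_of_notMem_tsupport fun h => hr (hs h)
    have hz' : ∀ r ∉ Set.Ioi (0 : ℝ), deriv g r = 0 := fun r hr =>
      image_eq_zero_of_notMem_tsupport fun h => hr (hs (tsupport_deriv_subset h))
    have hw := weak_darboux hf hg hgc hs
    rw [← hA, ← hB, setIntegral_eq_integral_of_forall_compl_eq_zero
      (fun r hr => by simp [hz r hr]), setIntegral_eq_integral_of_forall_compl_eq_zero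
      (fun r hr => by simp [hz' r hr])] at hw
    have hg' : ContDiff ℝ ∞ (deriv g) := (contDiff_infty_iff_deriv.1 hg).2
    have hCd : ContDiff ℝ ∞ (deriv C) := (contDiff_infty_iff_deriv.1 hCs).2
    have i1 : Integrable fun r => g r • deriv C r :=
      (hg.continuous.smul hCd.continuous).integrable_of_hasCompactSupport hgc.smul_right
    have i2 : Integrable fun r => deriv g r • C r :=
      (hg'.continuous.smul hCs.continuous).integrable_of_hasCompactSupport
        (HasCompactSupport.smul_right hgc.deriv)
    have i3 : Integrable fun r => g r • C r :=
      (hg.continuous.smul hCs.continuous).integrable_of_hasCompactSupport hgc.smul_right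
    have i4 : Integrable fun r : ℝ => g r • ((r : ℂ) ^ 2 * A r) :=
      (hg.continuous.smul ((hof.pow 2).mul hAs).continuous).integrable_of_hasCompactSupport
        hgc.smul_right
    have hparts : ∫ r, g r • deriv C r = - ∫ r, deriv g r • C r :=
      integral_smul_fderiv_eq_neg_fderiv_smul_of_integrable (v := (1 : ℝ)) (f := g) (g := C)
        i2 i1 i3 (fun r _ => (hg.differentiable (by simp)) r)
        (fun r _ => (hCs.differentiable (by simp)) r)
    simp only [hD, smul_sub]
    rw [integral_sub i4 i1, hparts, sub_neg_eq_add]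
    have e1 : ∀ r : ℝ, (r : ℂ) ^ 2 * ((g r : ℂ) * A r) = g r • ((r : ℂ) ^ 2 * A r) := fun r => by
      rw [Complex.real_smul]; ring
    have e2 : ∀ r : ℝ, (r : ℂ) ^ 2 * (((deriv g r : ℝ) : ℂ) * B r) = deriv g r • C r := fun r => by
      rw [Complex.real_smul]; simp only [hC]; ring
    simp only [e1, e2] at hw
    rw [hw, neg_add_cancel]
  have hall : Set.EqOn D 0 (Set.Ioi 0) := by
    refine Measure.eqOn_open_of_ae_eq (μ := volume) ?_ isOpen_Ioi hDc.continuousOn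
      continuousOn_const
    exact (ae_restrict_iff' measurableSet_Ioi).2 hae
  have h0 : D r = 0 := hall hr
  simp only [hD, hC'] at h0
  have hrc : (r : ℂ) ≠ 0 := by exact_mod_cast hr.ne'
  apply mul_left_cancel₀ hrc
  linear_combination -h0

/-! ### Calculus along curves and smooth waves. -/

section Curves

variable {V W : Type*} [NormedAddCommGroup V] [NormedSpace ℝ V]
  [NormedAddCommGroup W] [NormedSpace ℝ W] {f : V → ℂ}

theorem hasDerivAt_comp_curve (hf : ContDiff ℝ ∞ f) {γ : ℝ → V} {v : V} {s : ℝ}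
    (hγ : HasDerivAt γ v s) : HasDerivAt (fun s => f (γ s)) (pd v f (γ s)) s :=
  ((hf.differentiable (by simp)) (γ s)).hasFDerivAt.comp_hasDerivAt s hγ

theorem pd_comp (hf : ContDiff ℝ ∞ f) {g : W → V} {g' : W →L[ℝ] V} {x : W}
    (hg : HasFDerivAt g g' x) (w : W) : pd w (fun x => f (g x)) x = pd (g' w) f (g x) := by
  have h := (((hf.differentiable (by simp)) (g x)).hasFDerivAt.comp x hg).fderiv
  simp only [Function.comp_def] at h
  simp [pd, h]

theorem pd_neg_vec (v : V) (x : V) : pd (-v) f x = -pd v f x := by simp [pd]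

theorem pd_sub {g : V → ℂ} (hf : ContDiff ℝ ∞ f) (hg : ContDiff ℝ ∞ g) (v : V) :
    pd v (fun x => f x - g x) = fun x => pd v f x - pd v g x := by
  funext x
  simp only [pd]
  rw [fderiv_fun_sub ((hf.differentiable (by simp)) x) ((hg.differentiable (by simp)) x)]
  rfl

theorem pd_sum {ι : Type*} (s : Finset ι) {g : ι → V → ℂ} (hg : ∀ i, ContDiff ℝ ∞ (g i)) (v : V) :
    pd v (fun x => ∑ i ∈ s, g i x) = fun x => ∑ i ∈ s, pd v (g i) x := by
  funext x
  simp only [pd]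
  rw [fderiv_fun_sum fun i _ => ((hg i).differentiable (by simp)) x]
  simp

end Curves

/-- The time direction in space-time. -/
abbrev timeVec : ℝ × Space3 := (1, 0)

/-- The spatial coordinate directions in space-time. -/
noncomputable abbrev spaceVec (i : Fin 3) : ℝ × Space3 := (0, basisVec i)

/-- Smooth solutions of the wave equation, in terms of directional derivatives. -/
structure IsSmoothWave (u : ℝ × Space3 → ℂ) : Prop where
  contDiff : ContDiff ℝ ∞ u
  wave_eq : ∀ p, pd timeVec (pd timeVec u) p = ∑ i, pd (spaceVec i) (pd (spaceVec i) u) p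

/-- The hypothesis says that `r m` solves the one-dimensional wave equation. So `(∂ₜ + ∂ᵣ)(r m)` is
constant along the line `t + r = c`, and on the axis `r = 0` it equals `m`. -/
theorem darboux_characteristic {m : ℝ × ℝ → ℂ} (hm : ContDiff ℝ ∞ m)
    (h : ∀ t r : ℝ, 0 < r → 2 * pd (0, 1) m (t, r) + r * pd (0, 1) (pd (0, 1) m) (t, r) =
      r * pd (1, 0) (pd (1, 0) m) (t, r)) (c : ℝ) {r : ℝ} (hr : 0 ≤ r) :
    r * pd (1, 0) m (c - r, r) + m (c - r, r) + r * pd (0, 1) m (c - r, r) = m (c, 0) := by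
  have hmt := hm.pd (1, 0)
  have hmr := hm.pd (0, 1)
  -- Continuity extends the equation to `r = 0`, so that the characteristic can be followed down to
  -- the axis.
  have h' : ∀ t r : ℝ, 0 ≤ r → 2 * pd (0, 1) m (t, r) + r * pd (0, 1) (pd (0, 1) m) (t, r) =
      r * pd (1, 0) (pd (1, 0) m) (t, r) := by
    intro t r hr
    have e : Set.EqOn (fun r : ℝ => 2 * pd (0, 1) m (t, r) + r * pd (0, 1) (pd (0, 1) m) (t, r))
        (fun r : ℝ => r * pd (1, 0) (pd (1, 0) m) (t, r)) (Set.Ioi 0) := fun r hr => h t r hr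
    have := hmr.continuous
    have := (hmr.pd (0, 1)).continuous
    have := (hmt.pd (1, 0)).continuous
    have e' := e.closure (by fun_prop) (by fun_prop)
    rw [closure_Ioi] at e'
    exact e' hr
  have hγ : ∀ s : ℝ, HasDerivAt (fun s : ℝ => (c - s, s)) ((-1 : ℝ), (1 : ℝ)) s := fun s =>
    ((hasDerivAt_id s).const_sub c).prodMk (hasDerivAt_id s)
  have hsplit : ∀ (f : ℝ × ℝ → ℂ) (p : ℝ × ℝ), pd (-1, 1) f p = -pd (1, 0) f p + pd (0, 1) f p := by
    intro f p
    have : ((-1 : ℝ), (1 : ℝ)) = -(1, 0) + (0, 1) := by simp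
    simp only [pd]
    rw [this, map_add, map_neg]
  have hof : ∀ s : ℝ, HasDerivAt (fun s : ℝ => (s : ℂ)) 1 s := fun s =>
    Complex.ofRealCLM.hasDerivAt
  have hd : ∀ s : ℝ, 0 ≤ s → HasDerivAt (fun s : ℝ => (s : ℂ) * pd (1, 0) m (c - s, s) +
      m (c - s, s) + s * pd (0, 1) m (c - s, s)) 0 s := by
    intro s hs
    have d := (((hof s).mul (hasDerivAt_comp_curve hmt (hγ s))).add
      (hasDerivAt_comp_curve hm (hγ s))).add ((hof s).mul (hasDerivAt_comp_curve hmr (hγ s)))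
    refine d.congr_deriv ?_
    rw [hsplit, hsplit, hsplit, pd_comm hm (0, 1) (1, 0)]
    linear_combination h' (c - s) s hs
  have hconst := constant_of_has_deriv_right_zero (a := 0) (b := r)
    (fun s hs => (hd s hs.1).continuousAt.continuousWithinAt)
    (fun s hs => (hd s hs.1).hasDerivWithinAt) r ⟨hr, le_rfl⟩
  simpa using hconst

/-! ### Kirchhoff's formula. -/

section SphereMeans

variable {u : ℝ × Space3 → ℂ} (z : Space3)

theorem pd_sphere_integral {E : Type} [NormedAddCommGroup E] [NormedSpace ℝ E]
    [FiniteDimensional ℝ E] {f : E × Space3 → ℂ} (hf : ContDiff ℝ ∞ f) (v : E) :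
    pd v (fun x => ∫ θ : Sphere2, f (x, θ) ∂surf) =
      fun x => ∫ θ : Sphere2, pd (v, 0) f (x, θ) ∂surf :=
  funext fun x => fderiv_sphere_integral hf x v

/-- The spherical integrals of a function on space-time around the point `z`. -/
noncomputable def timeSphereMean (u : ℝ × Space3 → ℂ) (z : Space3) (p : ℝ × ℝ) : ℂ :=
  ∫ θ : Sphere2, u (p.1, z + p.2 • (θ : Space3)) ∂surf

theorem contDiff_sphereMap : ContDiff ℝ ∞
    (fun q : (ℝ × ℝ) × Space3 => (q.1.1, z + q.1.2 • q.2)) := by fun_prop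

theorem contDiff_timeSphereMean (hu : ContDiff ℝ ∞ u) : ContDiff ℝ ∞ (timeSphereMean u z) :=
  contDiff_sphere_integral (f := fun q : (ℝ × ℝ) × Space3 => u (q.1.1, z + q.1.2 • q.2))
    (hu.comp (contDiff_sphereMap z))

theorem pd_timeSphereMean (hu : ContDiff ℝ ∞ u) :
    pd (1, 0) (timeSphereMean u z) = timeSphereMean (pd timeVec u) z := by
  have h := pd_sphere_integral (E := ℝ × ℝ)
    (f := fun q : (ℝ × ℝ) × Space3 => u (q.1.1, z + q.1.2 • q.2))
    (hu.comp (contDiff_sphereMap z)) (1, 0)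
  refine h.trans (funext fun p => integral_congr_ae (Eventually.of_forall fun θ => ?_))
  have h1 : HasFDerivAt (fun q : (ℝ × ℝ) × Space3 => (q.1.1, z + q.1.2 • q.2)) _ (p, (θ : Space3)) :=
    (((contDiff_sphereMap z).differentiable (by simp)) _).hasFDerivAt
  beta_reduce
  rw [pd_comp hu h1]
  congr 1
  have h2 : HasDerivAt (fun s : ℝ => (((p.1 + s, p.2), (θ : Space3)) : (ℝ × ℝ) × Space3))
      ((1, 0), 0) 0 :=
    (((hasDerivAt_id (0 : ℝ)).const_add p.1).prodMk (hasDerivAt_const _ _)).prodMk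
      (hasDerivAt_const _ _)
  have h3 := HasFDerivAt.comp_hasDerivAt (x := (0 : ℝ)) (f := fun s : ℝ =>
    (((p.1 + s, p.2), (θ : Space3)) : (ℝ × ℝ) × Space3)) (by simpa using h1) h2
  have h4 : HasDerivAt (fun s : ℝ => (p.1 + s, z + p.2 • (θ : Space3))) timeVec 0 :=
    ((hasDerivAt_id (0 : ℝ)).const_add p.1).prodMk (hasDerivAt_const _ _)
  exact h3.unique h4

theorem timeSphereMean_eq (t r : ℝ) :
    timeSphereMean u z (t, r) = sphereMean (fun y => u (t, z + y)) r := rfl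

theorem pd_space_timeSphereMean {u : ℝ × Space3 → ℂ} (hu : ContDiff ℝ ∞ u) (t r : ℝ) :
    pd (0, 1) (timeSphereMean u z) (t, r) = deriv (sphereMean fun y => u (t, z + y)) r := by
  have h := hasDerivAt_comp_curve (contDiff_timeSphereMean z hu) (s := r) (γ := fun s => (t, s))
    (v := (0, 1)) ((hasDerivAt_const _ _).prodMk (hasDerivAt_id r))
  exact h.deriv.symm

theorem pd_slice (hu : ContDiff ℝ ∞ u) (t : ℝ) (v : Space3) :
    pd v (fun y => u (t, z + y)) = fun y => pd (0, v) u (t, z + y) := by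
  funext y
  have h : HasFDerivAt (fun y : Space3 => (t, z + y))
      ((0 : Space3 →L[ℝ] ℝ).prod (ContinuousLinearMap.id ℝ Space3)) y :=
    (hasFDerivAt_const _ _).prodMk ((hasFDerivAt_id y).const_add z)
  rw [pd_comp hu h]
  simp

theorem contDiff_slice (hu : ContDiff ℝ ∞ u) (t : ℝ) : ContDiff ℝ ∞ (fun y => u (t, z + y)) :=
  hu.comp (by fun_prop)

/-- Kirchhoff's formula, in terms of spherical means. -/
theorem IsSmoothWave.kirchhoff_mean (hu : IsSmoothWave u) (c : ℝ) {r : ℝ} (hr : 0 ≤ r) :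
    r * pd (1, 0) (timeSphereMean u z) (c - r, r) + timeSphereMean u z (c - r, r) +
      r * pd (0, 1) (timeSphereMean u z) (c - r, r) = surf.real Set.univ * u (c, z) := by
  rw [darboux_characteristic (contDiff_timeSphereMean z hu.contDiff) ?_ c hr]
  · simp [timeSphereMean]
  · intro t r hr
    have h1 := darboux (contDiff_slice z hu.contDiff t) hr
    have e1 : pd (0, 1) (pd (0, 1) (timeSphereMean u z)) (t, r) =
        deriv (deriv (sphereMean fun y => u (t, z + y))) r := by
      have h := hasDerivAt_comp_curve ((contDiff_timeSphereMean z hu.contDiff).pd (0, 1)) (s := r)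
        (γ := fun s => (t, s)) (v := (0, 1)) ((hasDerivAt_const _ _).prodMk (hasDerivAt_id r))
      rw [← h.deriv]
      simp only [pd_space_timeSphereMean z hu.contDiff]
    rw [pd_space_timeSphereMean z hu.contDiff, e1, h1, pd_timeSphereMean z hu.contDiff,
      pd_timeSphereMean z (hu.contDiff.pd _), timeSphereMean_eq]
    congr 2
    funext y
    rw [hu.wave_eq]
    refine Finset.sum_congr rfl fun i _ => ?_
    rw [pd_slice z hu.contDiff, pd_slice z (hu.contDiff.pd _)]

/-- Kirchhoff's formula. -/
theorem IsSmoothWave.kirchhoff (hu : IsSmoothWave u) (c : ℝ) {r : ℝ} (hr : 0 ≤ r) :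
    r * ∫ θ : Sphere2, pd timeVec u (c - r, z + r • (θ : Space3)) ∂surf +
      ∫ θ : Sphere2, u (c - r, z + r • (θ : Space3)) ∂surf +
      r * ∫ θ : Sphere2, pd (0, (θ : Space3)) u (c - r, z + r • (θ : Space3)) ∂surf =
      surf.real Set.univ * u (c, z) := by
  rw [← hu.kirchhoff_mean z c hr, pd_timeSphereMean z hu.contDiff,
    pd_space_timeSphereMean z hu.contDiff, deriv_sphereMean (contDiff_slice z hu.contDiff _)]
  have e : ∀ θ : Sphere2, fderiv ℝ (fun y => u (c - r, z + y)) (r • (θ : Space3)) θ =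
      pd (0, (θ : Space3)) u (c - r, z + r • (θ : Space3)) := fun θ =>
    congrFun (pd_slice z hu.contDiff (c - r) (θ : Space3)) (r • (θ : Space3))
  simp only [e]
  rfl

end SphereMeans

/-! ### Decay of integrals over large spheres. -/

section Decay

variable {F : Type*} [NormedAddCommGroup F] [NormedSpace ℝ F] [CompleteSpace F]

/-- Write `χ(z + Tθ)` as minus the integral of its radial derivative over `r > T`. There `1 ≤
r²/T²`, and `r² dr dθ` is Lebesgue measure, so `C = ∫‖Dχ‖` works for every centre `z`. -/
theorem exists_sphere_integral_norm_le {χ : Space3 → F} (hχ : ContDiff ℝ 1 χ)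
    (hc : HasCompactSupport χ) : ∃ C : ℝ, 0 ≤ C ∧ ∀ (z : Space3) (T : ℝ), 0 < T →
      ∫ θ : Sphere2, ‖χ (z + T • (θ : Space3))‖ ∂surf ≤ C / T ^ 2 := by
  have hD := hχ.continuous_fderiv one_ne_zero
  have hfin : ∫⁻ y, ‖fderiv ℝ χ y‖ₑ ≠ ⊤ :=
    (hD.integrable_of_hasCompactSupport (μ := volume) (hc.fderiv (𝕜 := ℝ))).2.ne
  refine ⟨(∫⁻ y, ‖fderiv ℝ χ y‖ₑ).toReal, ENNReal.toReal_nonneg, fun z T hT => ?_⟩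
  have hpt : ∀ θ : Sphere2, ‖χ (z + T • (θ : Space3))‖ₑ ≤
      ∫⁻ r in Set.Ioi T, ‖fderiv ℝ χ (z + r • (θ : Space3))‖ₑ := by
    intro θ
    set g : ℝ → F := fun r => χ (z + r • (θ : Space3)) with hg
    have hgd : ∀ r, HasDerivAt g (fderiv ℝ χ (z + r • (θ : Space3)) θ) r := by
      intro r
      have h1 : HasDerivAt (fun r : ℝ => z + r • (θ : Space3)) (θ : Space3) r := by
        simpa using ((hasDerivAt_id r).smul_const (θ : Space3)).const_add z
      exact ((hχ.differentiable one_ne_zero) _).hasFDerivAt.comp_hasDerivAt r h1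
    have hgc : HasCompactSupport g := by
      obtain ⟨b, hb⟩ := hc.isCompact.isBounded.subset_closedBall 0
      refine HasCompactSupport.of_support_subset_isCompact
        (isCompact_closedBall (0 : ℝ) (b + ‖z‖)) fun r hr => ?_
      have h1 : ‖z + r • (θ : Space3)‖ ≤ b := by simpa using hb (subset_tsupport χ hr)
      have h2 : ‖r • (θ : Space3)‖ ≤ ‖z + r • (θ : Space3)‖ + ‖z‖ := by
        simpa using norm_sub_le (z + r • (θ : Space3)) z
      rw [norm_smul, norm_eq_of_mem_sphere, mul_one] at h2
      simpa using h2.trans (by gcongr)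
    have h1 := HasCompactSupport.integral_Ioi_deriv_eq (f := g)
      (hχ.comp (by fun_prop)) hgc T
    rw [← enorm_neg, ← h1]
    refine (enorm_integral_le_lintegral_enorm _).trans (lintegral_mono fun r => ?_)
    rw [(hgd r).deriv, ← ofReal_norm, ← ofReal_norm]
    refine ENNReal.ofReal_le_ofReal (((fderiv ℝ χ _).le_opNorm _).trans ?_)
    rw [norm_eq_of_mem_sphere, mul_one]
  have hle : ∫⁻ θ : Sphere2, ‖χ (z + T • (θ : Space3))‖ₑ ∂surf ≤
      ENNReal.ofReal ((T ^ 2)⁻¹) * ∫⁻ y, ‖fderiv ℝ χ y‖ₑ := by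
    rw [← lintegral_add_left_eq_self _ z, lintegral_eq_lintegral_sphere (by fun_prop),
      ← lintegral_const_mul' _ _ ENNReal.ofReal_ne_top]
    refine lintegral_mono fun θ => (hpt θ).trans ?_
    rw [← lintegral_const_mul' _ _ ENNReal.ofReal_ne_top]
    refine (setLIntegral_mono' measurableSet_Ioi fun r hr => ?_).trans
      (lintegral_mono_set (Set.Ioi_subset_Ioi hT.le))
    rw [← mul_assoc, ← ENNReal.ofReal_mul (by positivity)]
    have hr' : T < r := hr
    have : 1 ≤ (T ^ 2)⁻¹ * r ^ 2 := by
      rw [inv_mul_eq_div, one_le_div (by positivity)]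
      gcongr
    exact le_mul_of_one_le_left' (ENNReal.one_le_ofReal.2 this)
  have hc0 := hχ.continuous
  rw [integral_norm_eq_lintegral_enorm (Continuous.aestronglyMeasurable (by fun_prop))]
  refine (ENNReal.toReal_mono (ENNReal.mul_ne_top ENNReal.ofReal_ne_top hfin) hle).trans ?_
  rw [ENNReal.toReal_mul, ENNReal.toReal_ofReal (by positivity), inv_mul_eq_div]

end Decay

theorem surf_real_univ_pos : 0 < surf.real Set.univ := by
  have h : surf ≠ 0 := (volume : Measure Space3).toSphere_ne_zero
  exact ENNReal.toReal_pos (fun h0 => h (Measure.measure_univ_eq_zero.1 h0)) (measure_ne_top _ _)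

section Conj

variable {V : Type*} [NormedAddCommGroup V] [NormedSpace ℝ V] {f : V → ℂ}

theorem ContDiff.conj (hf : ContDiff ℝ ∞ f) : ContDiff ℝ ∞ (fun x => conj (f x)) :=
  Complex.conjCLE.contDiff.comp hf

theorem pd_conj (hf : ContDiff ℝ ∞ f) (v : V) :
    pd v (fun x => conj (f x)) = fun x => conj (pd v f x) := by
  funext x
  have h := (Complex.conjCLE.hasFDerivAt (x := f x)).comp x
    ((hf.differentiable (by simp)) x).hasFDerivAt
  have h' := h.fderiv
  simp only [Function.comp_def, Complex.conjCLE_apply] at h'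
  simp [pd, h']

theorem pd_mul {g : V → ℂ} (hf : ContDiff ℝ ∞ f) (hg : ContDiff ℝ ∞ g) (v : V) :
    pd v (fun x => f x * g x) = fun x => pd v f x * g x + f x * pd v g x := by
  funext x
  simp only [pd]
  rw [fderiv_fun_mul ((hf.differentiable (by simp)) x) ((hg.differentiable (by simp)) x)]
  simp
  ring

end Conj

/-! ### Symmetries of the wave equation, Huygens' principle, pointwise decay. -/

section WaveOperations

variable {u v : ℝ × Space3 → ℂ}

theorem IsSmoothWave.conj (hu : IsSmoothWave u) : IsSmoothWave (fun p => conj (u p)) where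
  contDiff := hu.contDiff.conj
  wave_eq p := by
    rw [pd_conj hu.contDiff, pd_conj (hu.contDiff.pd _)]
    beta_reduce
    rw [hu.wave_eq, map_sum]
    refine Finset.sum_congr rfl fun i _ => ?_
    rw [pd_conj hu.contDiff, pd_conj (hu.contDiff.pd _)]

theorem IsSmoothWave.sub (hu : IsSmoothWave u) (hv : IsSmoothWave v) :
    IsSmoothWave (fun p => u p - v p) where
  contDiff := hu.contDiff.sub hv.contDiff
  wave_eq p := by
    rw [pd_sub hu.contDiff hv.contDiff, pd_sub (hu.contDiff.pd _) (hv.contDiff.pd _)]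
    beta_reduce
    rw [hu.wave_eq, hv.wave_eq, ← Finset.sum_sub_distrib]
    refine Finset.sum_congr rfl fun i _ => ?_
    rw [pd_sub hu.contDiff hv.contDiff, pd_sub (hu.contDiff.pd _) (hv.contDiff.pd _)]

theorem IsSmoothWave.timeDeriv (hu : IsSmoothWave u) : IsSmoothWave (pd timeVec u) where
  contDiff := hu.contDiff.pd _
  wave_eq p := by
    have h : pd timeVec (pd timeVec u) = fun p => ∑ i, pd (spaceVec i) (pd (spaceVec i) u) p :=
      funext hu.wave_eq
    rw [h, pd_sum _ fun i => (hu.contDiff.pd _).pd _]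
    refine Finset.sum_congr rfl fun i _ => ?_
    rw [pd_comm (hu.contDiff.pd _), pd_comm hu.contDiff timeVec]

/-- The time reversal map of space-time. -/
noncomputable def timeReversal : ℝ × Space3 →L[ℝ] ℝ × Space3 :=
  (-ContinuousLinearMap.fst ℝ ℝ Space3).prod (ContinuousLinearMap.snd ℝ ℝ Space3)

theorem pd_timeReversal (hu : ContDiff ℝ ∞ u) (w : ℝ × Space3) :
    pd w (fun p => u (timeReversal p)) = fun p => pd (timeReversal w) u (timeReversal p) :=
  funext fun _ => pd_comp hu timeReversal.hasFDerivAt w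

theorem IsSmoothWave.timeReversal (hu : IsSmoothWave u) :
    IsSmoothWave (fun p => u (timeReversal p)) where
  contDiff := hu.contDiff.comp (_root_.timeReversal).contDiff
  wave_eq p := by
    have e1 : _root_.timeReversal timeVec = -timeVec := by simp [_root_.timeReversal]
    have e2 : ∀ i, _root_.timeReversal (spaceVec i) = spaceVec i := fun i => by
      simp [_root_.timeReversal]
    rw [pd_timeReversal hu.contDiff, pd_timeReversal (hu.contDiff.pd _), e1]
    simp only [pd_neg_vec]
    have e3 : pd (-timeVec) u = fun p => -pd timeVec u p := funext fun p => pd_neg_vec _ _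
    rw [e3]
    have e4 : pd timeVec (fun p => -pd timeVec u p) (_root_.timeReversal p) =
        -pd timeVec (pd timeVec u) (_root_.timeReversal p) := by
      simp only [pd]
      rw [fderiv_fun_neg]
      rfl
    rw [e4, neg_neg, hu.wave_eq]
    refine Finset.sum_congr rfl fun i _ => ?_
    rw [pd_timeReversal hu.contDiff, pd_timeReversal (hu.contDiff.pd _), e2]

/-- The Cauchy data of `u` at time `0` are supported in the ball of radius `a`. -/
def DataSupportedIn (a : ℝ) (u : ℝ × Space3 → ℂ) : Prop :=
  ∀ z, a < ‖z‖ → u (0, z) = 0 ∧ pd timeVec u (0, z) = 0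

theorem pd_eq_zero_of_slice (hu : ContDiff ℝ ∞ u) {t b : ℝ}
    (h : ∀ z, b < ‖z‖ → u (t, z) = 0) (w : Space3) {z : Space3} (hz : b < ‖z‖) :
    pd (0, w) u (t, z) = 0 := by
  have h1 := congrFun (pd_slice 0 hu t w) z
  simp only [zero_add] at h1
  rw [← h1]
  have h2 : (fun y => u (t, y)) =ᶠ[𝓝 z] fun _ => 0 := by
    filter_upwards [(isOpen_lt continuous_const continuous_norm).mem_nhds hz] with y hy
    exact h y hy
  rw [pd, h2.fderiv_eq]
  simp

/-- The velocity of `∂ₜu` at time `0` is `Δu(0, ·)`. Support and decay results thus apply to `∂ₜu`,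
the function that enters the radiation field. -/
theorem DataSupportedIn.timeDeriv {a : ℝ} (h : DataSupportedIn a u) (hu : IsSmoothWave u) :
    DataSupportedIn a (pd timeVec u) := fun z hz => by
  refine ⟨(h z hz).2, ?_⟩
  rw [hu.wave_eq]
  refine Finset.sum_eq_zero fun i _ => pd_eq_zero_of_slice (hu.contDiff.pd _) (fun y hy => ?_) _ hz
  exact pd_eq_zero_of_slice hu.contDiff (fun x hx => (h x hx).1) _ hy

theorem DataSupportedIn.timeReversal {a : ℝ} (h : DataSupportedIn a u) (hu : IsSmoothWave u) :
    DataSupportedIn a (fun p => u (timeReversal p)) := fun z hz => by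
  have e0 : _root_.timeReversal (0, z) = (0, z) := by simp [_root_.timeReversal]
  rw [pd_timeReversal hu.contDiff]
  beta_reduce
  have e1 : _root_.timeReversal timeVec = -timeVec := by simp [_root_.timeReversal]
  rw [e0, e1, pd_neg_vec, (h z hz).1, (h z hz).2, neg_zero]
  exact ⟨rfl, rfl⟩

theorem IsSmoothWave.kirchhoff_data (hu : IsSmoothWave u) {t : ℝ} (ht : 0 ≤ t) (z : Space3) :
    t * ∫ θ : Sphere2, pd timeVec u (0, z + t • (θ : Space3)) ∂surf +
      ∫ θ : Sphere2, u (0, z + t • (θ : Space3)) ∂surf +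
      t * ∫ θ : Sphere2, pd (0, (θ : Space3)) u (0, z + t • (θ : Space3)) ∂surf =
      surf.real Set.univ * u (t, z) := by
  simpa using hu.kirchhoff z t ht

/-- Finite speed of propagation and Huygens' principle. -/
theorem IsSmoothWave.eq_zero_of_data {a : ℝ} (hu : IsSmoothWave u) (h : DataSupportedIn a u)
    {t : ℝ} {z : Space3} (hz : |t| + a < ‖z‖ ∨ ‖z‖ < |t| - a) : u (t, z) = 0 := by
  have key : ∀ {u : ℝ × Space3 → ℂ}, IsSmoothWave u → DataSupportedIn a u → ∀ {t : ℝ}, 0 ≤ t →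
      ∀ {z : Space3}, t + a < ‖z‖ ∨ ‖z‖ < t - a → u (t, z) = 0 := by
    intro u hu h t ht z hz
    -- In both cases the sphere of radius `t` about `z` misses the ball containing the data.
    have hfar : ∀ θ : Sphere2, a < ‖z + t • (θ : Space3)‖ := by
      intro θ
      have hn : ‖t • (θ : Space3)‖ = t := by
        rw [norm_smul, norm_eq_of_mem_sphere, mul_one, Real.norm_of_nonneg ht]
      have h1 := norm_sub_le (z + t • (θ : Space3)) (t • (θ : Space3))
      have h2 := norm_sub_le (z + t • (θ : Space3)) z
      simp only [add_sub_cancel_right, add_sub_cancel_left, hn] at h1 h2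
      rcases hz with hz | hz <;> linarith
    have hk := hu.kirchhoff_data ht z
    have e1 : ∀ θ : Sphere2, pd timeVec u (0, z + t • (θ : Space3)) = 0 := fun θ =>
      (h _ (hfar θ)).2
    have e2 : ∀ θ : Sphere2, u (0, z + t • (θ : Space3)) = 0 := fun θ => (h _ (hfar θ)).1
    have e3 : ∀ θ : Sphere2, pd (0, (θ : Space3)) u (0, z + t • (θ : Space3)) = 0 := fun θ =>
      pd_eq_zero_of_slice hu.contDiff (fun x hx => (h x hx).1) _ (hfar θ)
    simp only [e1, e2, e3, integral_zero, mul_zero, add_zero] at hk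
    have hκ := surf_real_univ_pos.ne'
    rcases mul_eq_zero.1 hk.symm with h0 | h0
    · exact absurd (by exact_mod_cast h0) hκ
    · exact h0
  rcases le_total 0 t with ht | ht
  · rw [abs_of_nonneg ht] at hz
    exact key hu h ht hz
  · rw [abs_of_nonpos ht] at hz
    have := key hu.timeReversal (h.timeReversal hu) (neg_nonneg.2 ht) hz
    simpa [_root_.timeReversal] using this

theorem contDiff_timeSlice (hu : ContDiff ℝ ∞ u) (t : ℝ) : ContDiff ℝ ∞ (fun y => u (t, y)) :=
  hu.comp (by fun_prop)

theorem hasCompactSupport_of_eq_zero {F : Type*} [Zero F] {f : Space3 → F} {b : ℝ}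
    (h : ∀ z, b < ‖z‖ → f z = 0) : HasCompactSupport f :=
  HasCompactSupport.of_support_subset_isCompact (isCompact_closedBall (0 : Space3) b) fun z hz => by
    by_contra hb
    exact hz (h z (by simpa using hb))

/-- The pointwise decay of waves with compactly supported data. -/
theorem IsSmoothWave.exists_decay {a : ℝ} (hu : IsSmoothWave u) (h : DataSupportedIn a u) :
    ∃ C : ℝ, 0 ≤ C ∧ ∀ (t : ℝ) (z : Space3), 1 ≤ t → ‖u (t, z)‖ ≤ C / t := by
  have s0 := contDiff_timeSlice hu.contDiff 0
  have s1 := contDiff_timeSlice (hu.contDiff.pd timeVec) 0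
  have c0 : HasCompactSupport (fun y => u (0, y)) :=
    hasCompactSupport_of_eq_zero fun z hz => (h z hz).1
  have c1 : HasCompactSupport (fun y => pd timeVec u (0, y)) :=
    hasCompactSupport_of_eq_zero fun z hz => (h z hz).2
  obtain ⟨C0, hC0, h0⟩ := exists_sphere_integral_norm_le (s0.of_le (by exact_mod_cast le_top)) c0
  obtain ⟨C1, hC1, h1⟩ := exists_sphere_integral_norm_le (s1.of_le (by exact_mod_cast le_top)) c1
  obtain ⟨C2, hC2, h2⟩ := exists_sphere_integral_norm_le
    ((s0.fderiv_right (m := ∞) (by simp)).of_le (by exact_mod_cast le_top))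
    (c0.fderiv (𝕜 := ℝ))
  have hκ := surf_real_univ_pos
  refine ⟨(C1 + C0 + C2) / surf.real Set.univ, by positivity, fun t z ht => ?_⟩
  have ht0 : 0 < t := by linarith
  have hk := hu.kirchhoff_data ht0.le z
  have b1 : ‖∫ θ : Sphere2, pd timeVec u (0, z + t • (θ : Space3)) ∂surf‖ ≤ C1 / t ^ 2 :=
    (norm_integral_le_integral_norm _).trans (h1 z t ht0)
  have b0 : ‖∫ θ : Sphere2, u (0, z + t • (θ : Space3)) ∂surf‖ ≤ C0 / t ^ 2 :=
    (norm_integral_le_integral_norm _).trans (h0 z t ht0)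
  have b2 : ‖∫ θ : Sphere2, pd (0, (θ : Space3)) u (0, z + t • (θ : Space3)) ∂surf‖ ≤
      C2 / t ^ 2 := by
    refine (norm_integral_le_of_norm_le (Continuous.integrable_surf ?_)
      (Eventually.of_forall fun θ => ?_)).trans (h2 z t ht0)
    · have := (s0.fderiv_right (m := ∞) (by simp)).continuous
      fun_prop
    · have e := congrFun (pd_slice 0 hu.contDiff 0 (θ : Space3)) (z + t • (θ : Space3))
      simp only [zero_add] at e
      rw [← e, pd]
      refine (ContinuousLinearMap.le_opNorm _ _).trans ?_
      rw [norm_eq_of_mem_sphere, mul_one]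
  -- Each sphere integral is `O(t⁻²)`; the two that carry a factor `t` decide the rate.
  have hn : surf.real Set.univ * ‖u (t, z)‖ ≤ (C1 + C0 + C2) / t := by
    calc surf.real Set.univ * ‖u (t, z)‖ = ‖(surf.real Set.univ : ℂ) * u (t, z)‖ := by
          rw [norm_mul, Complex.norm_real, Real.norm_of_nonneg hκ.le]
      _ ≤ t * (C1 / t ^ 2) + C0 / t ^ 2 + t * (C2 / t ^ 2) := by
          rw [← hk]
          refine norm_add₃_le.trans ?_
          rw [norm_mul, norm_mul, Complex.norm_real, Real.norm_of_nonneg ht0.le]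
          gcongr
      _ ≤ (C1 + C0 + C2) / t := by
          have e1 : t * (C1 / t ^ 2) = C1 / t := by field_simp
          have e2 : t * (C2 / t ^ 2) = C2 / t := by field_simp
          have e3 : C0 / t ^ 2 ≤ C0 / t := by
            apply div_le_div_of_nonneg_left hC0 ht0
            nlinarith
          rw [e1, e2, add_div, add_div]
          linarith
  rw [div_div, mul_comm (surf.real Set.univ), ← div_div, le_div_iff₀ hκ, mul_comm]
  exact hn

end WaveOperations

/-! ### Energy conservation and the virial identity. -/

section Energy

variable {a : ℝ} {f : ℝ × Space3 → ℂ}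

/-- `f` vanishes outside the light cone over the ball of radius `a`. -/
def ConeSupported (a : ℝ) (f : ℝ × Space3 → ℂ) : Prop :=
  ∀ (t : ℝ) (z : Space3), |t| + a < ‖z‖ → f (t, z) = 0

theorem ConeSupported.pd (h : ConeSupported a f) (w : ℝ × Space3) :
    ConeSupported a (pd w f) := fun t z hz => by
  have h2 : f =ᶠ[𝓝 (t, z)] fun _ => 0 := by
    have ho : IsOpen {p : ℝ × Space3 | |p.1| + a < ‖p.2‖} :=
      isOpen_lt (by fun_prop) (by fun_prop)
    filter_upwards [ho.mem_nhds hz] with p hp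
    exact h p.1 p.2 hp
  rw [_root_.pd, h2.fderiv_eq]
  simp

theorem ConeSupported.mul_right (h : ConeSupported a f) (g : ℝ × Space3 → ℂ) :
    ConeSupported a (fun p => f p * g p) := fun t z hz => by
  simp [h t z hz]

theorem ConeSupported.conj (h : ConeSupported a f) :
    ConeSupported a (fun p => conj (f p)) := fun t z hz => by
  simp [h t z hz]

theorem ConeSupported.hasCompactSupport (h : ConeSupported a f) (t : ℝ) :
    HasCompactSupport (fun z => f (t, z)) :=
  hasCompactSupport_of_eq_zero fun z hz => h t z hz

theorem ConeSupported.integrable (h : ConeSupported a f) (hf : ContDiff ℝ ∞ f) (t : ℝ) :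
    Integrable (fun z => f (t, z)) :=
  (contDiff_timeSlice hf t).continuous.integrable_of_hasCompactSupport (h.hasCompactSupport t)

theorem ConeSupported.hasDerivAt_integral (h : ConeSupported a f) (hf : ContDiff ℝ ∞ f) (t : ℝ) :
    HasDerivAt (fun t => ∫ z, f (t, z)) (∫ z, _root_.pd timeVec f (t, z)) t := by
  have hc : Continuous fun p => ‖_root_.pd timeVec f p‖ := (hf.pd _).continuous.norm
  obtain ⟨M, hM⟩ := ((isCompact_closedBall t 1).prod
    (isCompact_closedBall (0 : Space3) (|t| + 1 + a))).bddAbove_image hc.continuousOn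
  -- For times within `1` of `t` all slices of the cone lie in one fixed ball, on which the
  -- derivative is bounded.
  have hlt : ∀ s ∈ Metric.closedBall t 1, |s| ≤ |t| + 1 := by
    intro s hs
    have : |s - t| ≤ 1 := by simpa [Real.dist_eq] using hs
    have := abs_sub_abs_le_abs_sub s t
    linarith
  refine (hasDerivAt_integral_of_dominated_loc_of_deriv_le (s := Metric.closedBall t 1)
    (bound := (Metric.closedBall (0 : Space3) (|t| + 1 + a)).indicator fun _ => M)
    (F' := fun t z => _root_.pd timeVec f (t, z))
    (Metric.closedBall_mem_nhds t one_pos) (Eventually.of_forall fun s => ?_)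
    (h.integrable hf t) ?_ ?_ ?_ ?_).2
  · exact (h.integrable hf s).aestronglyMeasurable
  · exact ((h.pd _).integrable (hf.pd _) t).aestronglyMeasurable
  · refine Eventually.of_forall fun z s hs => ?_
    by_cases hz : z ∈ Metric.closedBall (0 : Space3) (|t| + 1 + a)
    · rw [Set.indicator_of_mem hz]
      exact hM ⟨(s, z), ⟨hs, hz⟩, rfl⟩
    · rw [Set.indicator_of_notMem hz, (h.pd timeVec) s z ?_, norm_zero]
      have h1 : |t| + 1 + a < ‖z‖ := by simpa using hz
      linarith [hlt s hs]
  · exact (integrable_indicator_iff Metric.isClosed_closedBall.measurableSet).2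
      (integrableOn_const (isCompact_closedBall _ _).measure_lt_top.ne)
  · refine Eventually.of_forall fun z s _ => ?_
    exact hasDerivAt_comp_curve hf ((hasDerivAt_id s).prodMk (hasDerivAt_const s z))

theorem integral_mul_pd_slice {g : ℝ × Space3 → ℂ} (hf : ContDiff ℝ ∞ f) (hg : ContDiff ℝ ∞ g)
    (h : ConeSupported a f) (t : ℝ) (w : Space3) :
    ∫ z, f (t, z) * pd (0, w) g (t, z) = - ∫ z, pd (0, w) f (t, z) * g (t, z) := by
  have e := integral_mul_pd (μ := volume) (contDiff_timeSlice hf t) (contDiff_timeSlice hg t)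
    (h.hasCompactSupport t) w
  have e1 := pd_slice 0 hf t w
  have e2 := pd_slice 0 hg t w
  simp only [zero_add] at e1 e2
  rwa [e1, e2] at e

variable {u v : ℝ × Space3 → ℂ}

theorem integral_mul_pd_time_time (hu : IsSmoothWave u) {f : ℝ × Space3 → ℂ}
    (hf : ContDiff ℝ ∞ f) (h : ConeSupported a f) (t : ℝ) :
    ∫ z, f (t, z) * pd timeVec (pd timeVec u) (t, z) =
      - ∑ i, ∫ z, pd (spaceVec i) f (t, z) * pd (spaceVec i) u (t, z) := by
  simp only [hu.wave_eq, Finset.mul_sum]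
  rw [integral_finsetSum, ← Finset.sum_neg_distrib]
  · exact Finset.sum_congr rfl fun i _ => integral_mul_pd_slice hf (hu.contDiff.pd _) h t _
  · exact fun i _ => (h.mul_right _).integrable (hf.mul ((hu.contDiff.pd _).pd _)) t

/-- The kinetic part of the bilinear energy. -/
noncomputable def kinetic (v u : ℝ × Space3 → ℂ) (t : ℝ) : ℂ :=
  ∫ z, pd timeVec v (t, z) * pd timeVec u (t, z)

/-- The potential part of the bilinear energy. -/
noncomputable def potential (v u : ℝ × Space3 → ℂ) (t : ℝ) : ℂ :=
  ∑ i, ∫ z, pd (spaceVec i) v (t, z) * pd (spaceVec i) u (t, z)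

/-- The form is bilinear, without conjugation, so that products can be differentiated directly; it
is later used with `v` the conjugate of `u`. Integration by parts in space cancels the two
contributions. -/
theorem hasDerivAt_energy (hv : IsSmoothWave v) (hu : IsSmoothWave u) (sv : ConeSupported a v)
    (su : ConeSupported a u) (t : ℝ) :
    HasDerivAt (fun t => kinetic v u t + potential v u t) 0 t := by
  have hK := ((sv.pd timeVec).mul_right (pd timeVec u)).hasDerivAt_integral
    ((hv.contDiff.pd _).mul (hu.contDiff.pd _)) t
  have hP : ∀ i, HasDerivAt (fun t => ∫ z, pd (spaceVec i) v (t, z) * pd (spaceVec i) u (t, z)) _ t :=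
    fun i => ((sv.pd (spaceVec i)).mul_right (pd (spaceVec i) u)).hasDerivAt_integral
      ((hv.contDiff.pd _).mul (hu.contDiff.pd _)) t
  refine (hK.add (HasDerivAt.fun_sum fun i _ => hP i)).congr_deriv ?_
  rw [pd_mul (hv.contDiff.pd _) (hu.contDiff.pd _)]
  have e1 := integral_mul_pd_time_time hu (hv.contDiff.pd timeVec) (sv.pd timeVec) t
  have e2 := integral_mul_pd_time_time hv (hu.contDiff.pd timeVec) (su.pd timeVec) t
  have i1 := ((sv.pd timeVec).mul_right (pd timeVec (pd timeVec u))).integrable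
    ((hv.contDiff.pd _).mul ((hu.contDiff.pd _).pd _)) t
  have i2 := (((sv.pd timeVec).pd timeVec).mul_right (pd timeVec u)).integrable
    (((hv.contDiff.pd _).pd _).mul (hu.contDiff.pd _)) t
  rw [integral_add i2 i1, e1]
  have e2' : ∫ z, pd timeVec (pd timeVec v) (t, z) * pd timeVec u (t, z) =
      - ∑ i, ∫ z, pd (spaceVec i) v (t, z) * pd (spaceVec i) (pd timeVec u) (t, z) := by
    simp only [mul_comm] at e2 ⊢
    exact e2
  rw [e2', ← neg_add, ← Finset.sum_add_distrib, ← sub_eq_neg_add, sub_eq_zero]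
  refine Finset.sum_congr rfl fun i _ => ?_
  rw [pd_mul (hv.contDiff.pd _) (hu.contDiff.pd _), pd_comm hv.contDiff timeVec,
    pd_comm hu.contDiff timeVec]
  have i3 := (((sv.pd timeVec).pd (spaceVec i)).mul_right (pd (spaceVec i) u)).integrable
    (((hv.contDiff.pd _).pd _).mul (hu.contDiff.pd _)) t
  have i4 := ((sv.pd (spaceVec i)).mul_right (pd (spaceVec i) (pd timeVec u))).integrable
    ((hv.contDiff.pd _).mul ((hu.contDiff.pd _).pd _)) t
  rw [integral_add i3 i4, add_comm]

theorem energy_conservation (hv : IsSmoothWave v) (hu : IsSmoothWave u) (sv : ConeSupported a v)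
    (su : ConeSupported a u) (t : ℝ) :
    kinetic v u t + potential v u t = kinetic v u 0 + potential v u 0 :=
  is_const_of_deriv_eq_zero (fun t => (hasDerivAt_energy hv hu sv su t).differentiableAt)
    (fun t => (hasDerivAt_energy hv hu sv su t).deriv) t 0

theorem hasDerivAt_integral_mul (hv : IsSmoothWave v) (hu : IsSmoothWave u)
    (sv : ConeSupported a v) (t : ℝ) :
    HasDerivAt (fun t => ∫ z, v (t, z) * u (t, z))
      (∫ z, (pd timeVec v (t, z) * u (t, z) + v (t, z) * pd timeVec u (t, z))) t := by
  have h := (sv.mul_right u).hasDerivAt_integral (hv.contDiff.mul hu.contDiff) t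
  rwa [pd_mul hv.contDiff hu.contDiff] at h

/-- In `∂ₜ²(vu) = u ∂ₜ²v + v ∂ₜ²u + 2 ∂ₜv ∂ₜu`, each of the first two terms integrates to minus the
potential energy. -/
theorem hasDerivAt_deriv_integral_mul (hv : IsSmoothWave v) (hu : IsSmoothWave u)
    (sv : ConeSupported a v) (su : ConeSupported a u) (t : ℝ) :
    HasDerivAt (fun t => ∫ z, (pd timeVec v (t, z) * u (t, z) + v (t, z) * pd timeVec u (t, z)))
      (2 * kinetic v u t - 2 * potential v u t) t := by
  have s1 : ConeSupported a (fun p => pd timeVec v p * u p + v p * pd timeVec u p) := by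
    intro t z hz
    simp [sv t z hz, su t z hz]
  have h := s1.hasDerivAt_integral
    (((hv.contDiff.pd _).mul hu.contDiff).add (hv.contDiff.mul (hu.contDiff.pd _))) t
  refine h.congr_deriv ?_
  have e : pd timeVec (fun p => pd timeVec v p * u p + v p * pd timeVec u p) =
      fun p => u p * pd timeVec (pd timeVec v) p + v p * pd timeVec (pd timeVec u) p +
        2 * (pd timeVec v p * pd timeVec u p) := by
    have d1 := (hv.contDiff.pd timeVec).mul hu.contDiff
    have d2 := hv.contDiff.mul (hu.contDiff.pd timeVec)
    have : pd timeVec (fun p => pd timeVec v p * u p + v p * pd timeVec u p) =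
      fun p => pd timeVec (fun p => pd timeVec v p * u p) p +
        pd timeVec (fun p => v p * pd timeVec u p) p := by
      funext p
      simp only [pd] at d1 d2 ⊢
      rw [fderiv_fun_add ((d1.differentiable (by simp)) p) ((d2.differentiable (by simp)) p)]
      rfl
    rw [this, pd_mul (hv.contDiff.pd _) hu.contDiff, pd_mul hv.contDiff (hu.contDiff.pd _)]
    funext p
    ring
  rw [e]
  have i1 := (su.mul_right (pd timeVec (pd timeVec v))).integrable
    (hu.contDiff.mul ((hv.contDiff.pd _).pd _)) t
  have i2 := (sv.mul_right (pd timeVec (pd timeVec u))).integrable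
    (hv.contDiff.mul ((hu.contDiff.pd _).pd _)) t
  have i3 := ((sv.pd timeVec).mul_right (pd timeVec u)).integrable
    ((hv.contDiff.pd _).mul (hu.contDiff.pd _)) t
  beta_reduce
  rw [integral_add (by exact i1.add i2) (i3.const_mul 2), integral_add i1 i2, integral_const_mul,
    integral_mul_pd_time_time hu hv.contDiff sv, integral_mul_pd_time_time hv hu.contDiff su]
  have e3 : ∑ i, ∫ z, pd (spaceVec i) u (t, z) * pd (spaceVec i) v (t, z) = potential v u t := by
    simp only [potential, mul_comm]
  rw [e3]
  change -potential v u t + -potential v u t + 2 * kinetic v u t = _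
  ring

end Energy

/-! ### Passage to null infinity. -/

/-- `|r w(t, r θ)|²` in terms of the retarded time `s = t - r`. -/
noncomputable def shellDensity (w : ℝ × Space3 → ℂ) (t : ℝ) (p : ℝ × Sphere2) : ENNReal :=
  Set.indicator {p : ℝ × Sphere2 | p.1 < t}
    (fun p => ‖((t - p.1 : ℝ) : ℂ) * w (t, (t - p.1) • (p.2 : Space3))‖ₑ ^ 2) p

theorem measurable_shellDensity {w : ℝ × Space3 → ℂ} (hw : Continuous w) (t : ℝ) :
    Measurable (shellDensity w t) := by
  refine Measurable.indicator ?_ (measurableSet_lt measurable_fst measurable_const)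
  refine Measurable.pow_const (Continuous.measurable ?_).enorm 2
  fun_prop

/-- Polar coordinates with `r = t - s`; the Jacobian `r²` is absorbed into `|r w|²`. -/
theorem lintegral_shellDensity {w : ℝ × Space3 → ℂ} (hw : Continuous w) (t : ℝ) :
    ∫⁻ z, ‖w (t, z)‖ₑ ^ 2 = ∫⁻ p, shellDensity w t p ∂cylinderMeasure := by
  rw [cylinderMeasure, lintegral_prod_symm' _ (measurable_shellDensity hw t),
    lintegral_eq_lintegral_sphere (f := fun z => ‖w (t, z)‖ₑ ^ 2)
      (Measurable.pow_const (hw.comp (by fun_prop)).measurable.enorm 2)]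
  refine lintegral_congr fun θ => ?_
  rw [← lintegral_indicator measurableSet_Ioi, ← lintegral_sub_left_eq_self _ t]
  refine lintegral_congr fun s => ?_
  by_cases hs : s < t
  · have h1 : t - s ∈ Set.Ioi (0 : ℝ) := sub_pos.2 hs
    have h2 : (s, θ) ∈ {p : ℝ × Sphere2 | p.1 < t} := hs
    rw [Set.indicator_of_mem h1, shellDensity, Set.indicator_of_mem h2]
    rw [enorm_mul, mul_pow]
    congr 1
    rw [← ofReal_norm, Complex.norm_real, ← ENNReal.ofReal_pow (norm_nonneg _), Real.norm_eq_abs,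
      sq_abs]
  · have h1 : t - s ∉ Set.Ioi (0 : ℝ) := fun h => hs (sub_pos.1 h)
    have h2 : (s, θ) ∉ {p : ℝ × Sphere2 | p.1 < t} := hs
    rw [Set.indicator_of_notMem h1, shellDensity, Set.indicator_of_notMem h2]

/-- Dominated convergence in the retarded time. The support condition confines `s` to `[-a, a]`; for
`t ≥ 1` one has `t - s ≤ (1 + |a|) t` there, which the decay `C/t` compensates. -/
theorem tendsto_lintegral_radiation {w : ℝ × Space3 → ℂ} (hw : Continuous w) {a C : ℝ}
    (hsupp : ∀ (t : ℝ) (z : Space3), |t| + a < ‖z‖ ∨ ‖z‖ < |t| - a → w (t, z) = 0)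
    (hdecay : ∀ (t : ℝ) (z : Space3), 1 ≤ t → ‖w (t, z)‖ ≤ C / t) {G : ℝ × Sphere2 → ℂ}
    (hG : ∀ (s : ℝ) (θ : Sphere2),
      Tendsto (fun r : ℝ => (r : ℂ) * w (s + r, r • (θ : Space3))) atTop (𝓝 (G (s, θ)))) :
    Tendsto (fun t => ∫⁻ z, ‖w (t, z)‖ₑ ^ 2) atTop (𝓝 (∫⁻ p, ‖G p‖ₑ ^ 2 ∂cylinderMeasure)) := by
  simp only [lintegral_shellDensity hw]
  refine tendsto_lintegral_filter_of_dominated_convergence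
    ((Set.Icc (-a) a ×ˢ (Set.univ : Set Sphere2)).indicator fun _ =>
      ENNReal.ofReal ((1 + |a|) * C) ^ 2)
    (Eventually.of_forall fun t => measurable_shellDensity hw t) ?_ ?_ ?_
  · filter_upwards [eventually_ge_atTop 1] with t ht
    refine Eventually.of_forall fun p => ?_
    obtain ⟨s, θ⟩ := p
    by_cases hs : s < t
    swap
    · have h2 : (s, θ) ∉ {p : ℝ × Sphere2 | p.1 < t} := hs
      rw [shellDensity, Set.indicator_of_notMem h2]
      exact zero_le
    have h2 : (s, θ) ∈ {p : ℝ × Sphere2 | p.1 < t} := hs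
    have hn : ‖(t - s) • (θ : Space3)‖ = t - s := by
      rw [norm_smul, norm_eq_of_mem_sphere, mul_one, Real.norm_of_nonneg (by linarith)]
    rw [shellDensity, Set.indicator_of_mem h2]
    have ht0 : 0 < t := by linarith
    by_cases hsa : s ∈ Set.Icc (-a) a
    · rw [Set.indicator_of_mem (show (s, θ) ∈ Set.Icc (-a) a ×ˢ (Set.univ : Set Sphere2) from
        ⟨hsa, Set.mem_univ θ⟩)]
      gcongr
      rw [← ofReal_norm]
      refine ENNReal.ofReal_le_ofReal ?_
      rw [norm_mul, Complex.norm_real, Real.norm_of_nonneg (by linarith)]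
      have h3 : t - s ≤ (1 + |a|) * t := by
        have := hsa.1
        have := le_abs_self a
        nlinarith [abs_nonneg a]
      calc (t - s) * ‖w (t, (t - s) • (θ : Space3))‖ ≤ ((1 + |a|) * t) * (C / t) := by
            gcongr
            exact hdecay t _ ht
        _ = (1 + |a|) * C := by field_simp
    · have h0 : w (t, (t - s) • (θ : Space3)) = 0 := by
        apply hsupp
        rw [hn, abs_of_pos ht0]
        by_contra hcon
        push Not at hcon
        exact hsa ⟨by linarith [hcon.1], by linarith [hcon.2]⟩
      simp [h0]
  · rw [lintegral_indicator (measurableSet_Icc.prod MeasurableSet.univ), lintegral_const,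
      Measure.restrict_apply_univ, cylinderMeasure, Measure.prod_prod]
    refine ENNReal.mul_ne_top (ENNReal.pow_ne_top ENNReal.ofReal_ne_top)
      (ENNReal.mul_ne_top ?_ (measure_ne_top _ _))
    simp
  · refine Eventually.of_forall fun p => ?_
    obtain ⟨s, θ⟩ := p
    have h1 : Tendsto (fun t : ℝ => t - s) atTop atTop := tendsto_atTop_add_const_right _ _ tendsto_id
    have h2 := (hG s θ).comp h1
    have h3 := ((ENNReal.continuous_pow 2).tendsto _).comp (h2.enorm)
    refine h3.congr' ?_
    filter_upwards [eventually_gt_atTop s] with t ht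
    have hm : (s, θ) ∈ {p : ℝ × Sphere2 | p.1 < t} := ht
    rw [shellDensity, Set.indicator_of_mem hm]
    simp

theorem measurable_radiation {w : ℝ × Space3 → ℂ} (hw : Continuous w) {G : ℝ × Sphere2 → ℂ}
    (hG : ∀ (s : ℝ) (θ : Sphere2),
      Tendsto (fun r : ℝ => (r : ℂ) * w (s + r, r • (θ : Space3))) atTop (𝓝 (G (s, θ)))) :
    Measurable G := by
  refine measurable_of_tendsto_metrizable (f := fun (n : ℕ) (p : ℝ × Sphere2) =>
    ((n : ℝ) : ℂ) * w (p.1 + n, (n : ℝ) • (p.2 : Space3)))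
    (fun n => Continuous.measurable (by fun_prop)) ?_
  exact tendsto_pi_nhds.2 fun p => (hG p.1 p.2).comp tendsto_natCast_atTop_atTop

/-- From time `T` on, `n` lies below a parabola opening downwards. -/
theorem exists_neg_of_second_deriv_le {n n' n'' : ℝ → ℝ} (h1 : ∀ t, HasDerivAt n (n' t) t)
    (h2 : ∀ t, HasDerivAt n' (n'' t) t) {δ T : ℝ} (hδ : 0 < δ) (h : ∀ t, T ≤ t → n'' t ≤ -δ) :
    ∃ t, n t < 0 := by
  have a1 : AntitoneOn (fun t => n' t + δ * (t - T)) (Set.Ici T) := by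
    have hd : ∀ t, HasDerivAt (fun t => n' t + δ * (t - T)) (n'' t + δ) t := fun t =>
      ((h2 t).add (((hasDerivAt_id t).sub_const T).const_mul δ)).congr_deriv (by simp)
    refine antitoneOn_of_deriv_nonpos (convex_Ici T)
      (fun t _ => (hd t).continuousAt.continuousWithinAt)
      (fun t _ => (hd t).differentiableAt.differentiableWithinAt) fun t ht => ?_
    rw [interior_Ici] at ht
    rw [(hd t).deriv]
    linarith [h t (le_of_lt ht)]
  have a2 : AntitoneOn (fun t => n t - n' T * (t - T) + δ / 2 * (t - T) ^ 2) (Set.Ici T) := by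
    have hd : ∀ t, HasDerivAt (fun t => n t - n' T * (t - T) + δ / 2 * (t - T) ^ 2)
        (n' t - n' T + δ * (t - T)) t := fun t => by
      have d := ((h1 t).sub (((hasDerivAt_id t).sub_const T).const_mul (n' T))).add
        ((((hasDerivAt_id t).sub_const T).pow 2).const_mul (δ / 2))
      refine d.congr_deriv ?_
      simp
      ring
    refine antitoneOn_of_deriv_nonpos (convex_Ici T)
      (fun t _ => (hd t).continuousAt.continuousWithinAt)
      (fun t _ => (hd t).differentiableAt.differentiableWithinAt) fun t ht => ?_
    rw [interior_Ici] at ht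
    rw [(hd t).deriv]
    have := a1 Set.self_mem_Ici (le_of_lt ht : T ≤ t) (le_of_lt ht)
    simp only [sub_self, mul_zero, add_zero] at this
    linarith
  -- Chosen so that `δx/2` exceeds `|n' T| + |n T| + 1`; since `x ≥ 1`, the quadratic term then
  -- beats both the linear and the constant one.
  set x := (2 * (|n' T| + |n T| + 1)) / δ + 1 with hx
  have hx1 : 1 ≤ x := by
    have : 0 ≤ (2 * (|n' T| + |n T| + 1)) / δ := by positivity
    linarith
  refine ⟨T + x, ?_⟩
  have h3 := a2 (Set.self_mem_Ici (a := T)) (show T ≤ T + x by linarith) (by linarith)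
  simp only [sub_self, mul_zero, add_sub_cancel_left] at h3
  have h4 : δ * x = 2 * (|n' T| + |n T| + 1) + δ := by rw [hx]; field_simp
  have h5 := le_abs_self (n T)
  have h6 := le_abs_self (n' T)
  have h7 : δ / 2 * x ^ 2 = (|n' T| + |n T| + 1 + δ / 2) * x := by
    linear_combination (x / 2) * h4
  rw [h7] at h3
  nlinarith [mul_le_mul_of_nonneg_right h6 (by linarith : (0 : ℝ) ≤ x),
    mul_le_mul_of_nonneg_left hx1 (abs_nonneg (n T)), mul_pos hδ (by linarith : (0 : ℝ) < x)]

/-! ### The energy bound. -/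

section Bound

variable {u : ℝ × Space3 → ℂ} {a : ℝ}

theorem IsSmoothWave.coneSupported (hu : IsSmoothWave u) (h : DataSupportedIn a u) :
    ConeSupported a u := fun _ _ hz => hu.eq_zero_of_data h (Or.inl hz)

theorem ofReal_re_integral_conj_mul {f : Space3 → ℂ} (hf : Continuous f)
    (hc : HasCompactSupport f) :
    ENNReal.ofReal (∫ z, conj (f z) * f z).re = ∫⁻ z, ‖f z‖ₑ ^ 2 := by
  have e : ∀ z, conj (f z) * f z = ((‖f z‖ ^ 2 : ℝ) : ℂ) := fun z => by
    rw [← Complex.normSq_eq_conj_mul_self, Complex.normSq_eq_norm_sq]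
  simp only [e]
  rw [integral_complex_ofReal, Complex.ofReal_re, ofReal_integral_eq_lintegral_ofReal]
  · refine lintegral_congr fun z => ?_
    rw [ENNReal.ofReal_pow (norm_nonneg _), ofReal_norm]
  · have hc2 : HasCompactSupport fun z => ‖f z‖ ^ 2 :=
      hc.comp_left (g := fun w : ℂ => ‖w‖ ^ 2) (by simp)
    exact (hf.norm.pow 2).integrable_of_hasCompactSupport hc2
  · exact Eventually.of_forall fun z => by positivity

theorem re_integral_conj_mul_nonneg (f : Space3 → ℂ) : 0 ≤ (∫ z, conj (f z) * f z).re := by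
  have e : ∀ z, conj (f z) * f z = ((‖f z‖ ^ 2 : ℝ) : ℂ) := fun z => by
    rw [← Complex.normSq_eq_conj_mul_self, Complex.normSq_eq_norm_sq]
  simp only [e]
  rw [integral_complex_ofReal, Complex.ofReal_re]
  exact integral_nonneg fun z => by positivity

/-- The energy of the data is bounded by the norm of the radiation field. -/
theorem IsSmoothWave.energy_le (hu : IsSmoothWave u) (h : DataSupportedIn a u)
    {G : ℝ × Sphere2 → ℂ} (hG : ∀ (s : ℝ) (θ : Sphere2),
      Tendsto (fun r : ℝ => (r : ℂ) * pd timeVec u (s + r, r • (θ : Space3))) atTop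
        (𝓝 (G (s, θ)))) :
    (∫⁻ z, ‖pd timeVec u (0, z)‖ₑ ^ 2) + ∑ i, ∫⁻ z, ‖pd (spaceVec i) u (0, z)‖ₑ ^ 2 ≤
      2 * ∫⁻ p, ‖G p‖ₑ ^ 2 ∂cylinderMeasure := by
  have su := hu.coneSupported h
  have hv := hu.conj
  have sv := su.conj
  set v : ℝ × Space3 → ℂ := fun p => conj (u p) with hvdef
  have hcont : ∀ (w : ℝ × Space3) (t : ℝ), Continuous fun z => pd w u (t, z) := fun w t =>
    (contDiff_timeSlice (hu.contDiff.pd w) t).continuous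
  have hkin : ∀ t, kinetic v u t = ∫ z, conj (pd timeVec u (t, z)) * pd timeVec u (t, z) :=
    fun t => by rw [kinetic, hvdef, pd_conj hu.contDiff]
  have hpot : ∀ t, potential v u t =
      ∑ i, ∫ z, conj (pd (spaceVec i) u (t, z)) * pd (spaceVec i) u (t, z) := fun t => by
    simp only [potential, hvdef, pd_conj hu.contDiff]
  have kin_eq : ∀ t, ENNReal.ofReal (kinetic v u t).re = ∫⁻ z, ‖pd timeVec u (t, z)‖ₑ ^ 2 :=
    fun t => by
      rw [hkin]
      exact ofReal_re_integral_conj_mul (hcont _ t) ((su.pd _).hasCompactSupport t)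
  have kin_nonneg : ∀ t, 0 ≤ (kinetic v u t).re := fun t => by
    rw [hkin]
    exact re_integral_conj_mul_nonneg _
  have pot_nonneg : 0 ≤ (potential v u 0).re := by
    rw [hpot, Complex.re_sum]
    exact Finset.sum_nonneg fun i _ => re_integral_conj_mul_nonneg _
  have pot_eq : ENNReal.ofReal (potential v u 0).re =
      ∑ i, ∫⁻ z, ‖pd (spaceVec i) u (0, z)‖ₑ ^ 2 := by
    rw [hpot, Complex.re_sum,
      ENNReal.ofReal_sum_of_nonneg fun i _ => re_integral_conj_mul_nonneg _]
    exact Finset.sum_congr rfl fun i _ =>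
      ofReal_re_integral_conj_mul (hcont _ 0) ((su.pd _).hasCompactSupport 0)
  rw [← kin_eq, ← pot_eq, ← ENNReal.ofReal_add (kin_nonneg 0) pot_nonneg]
  set q := (kinetic v u 0).re + (potential v u 0).re with hq
  obtain ⟨C, -, hdecay⟩ := hu.timeDeriv.exists_decay (h.timeDeriv hu)
  have hlim := tendsto_lintegral_radiation (hu.contDiff.pd timeVec).continuous
    (fun t z hz => hu.timeDeriv.eq_zero_of_data (h.timeDeriv hu) hz) hdecay hG
  set L := ∫⁻ p, ‖G p‖ₑ ^ 2 ∂cylinderMeasure with hL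
  by_contra! hcon
  have hLtop : L ≠ ⊤ := by
    rintro hLt
    rw [hLt] at hcon
    simp at hcon
  simp only [← kin_eq] at hlim
  have hlim' : Tendsto (fun t => (kinetic v u t).re) atTop (𝓝 L.toReal) := by
    refine ((ENNReal.tendsto_toReal hLtop).comp hlim).congr fun t => ?_
    exact ENNReal.toReal_ofReal (kin_nonneg t)
  have hlt : 2 * L.toReal < q := by
    have h1 := (ENNReal.toReal_lt_toReal (ENNReal.mul_ne_top (by simp) hLtop)
      ENNReal.ofReal_ne_top).2 hcon
    rwa [ENNReal.toReal_mul, ENNReal.toReal_ofNat,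
      ENNReal.toReal_ofReal (add_nonneg (kin_nonneg 0) pot_nonneg)] at h1
  -- With energy `q`, the second derivative of `∫|u|²` has real part `4 · kinetic - 2q`. The
  -- threshold `(2L + q)/4` makes it less than `2L - q`, and it lies above `L` because `2L < q`.
  have hev : ∀ᶠ t in atTop, (kinetic v u t).re < (2 * L.toReal + q) / 4 :=
    hlim'.eventually_lt_const (by linarith)
  obtain ⟨T, hT⟩ := eventually_atTop.1 hev
  have hre : ∀ {f : ℝ → ℂ} {f' : ℂ} {t : ℝ}, HasDerivAt f f' t →
      HasDerivAt (fun t => (f t).re) f'.re t := fun hf =>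
    Complex.reCLM.hasFDerivAt.comp_hasDerivAt _ hf
  obtain ⟨t, ht⟩ := exists_neg_of_second_deriv_le (δ := q - 2 * L.toReal) (T := T)
    (fun t => hre (hasDerivAt_integral_mul hv hu sv t))
    (fun t => hre (hasDerivAt_deriv_integral_mul hv hu sv su t)) (by linarith) fun t ht => by
      have e := congrArg Complex.re (energy_conservation hv hu sv su t)
      simp only [Complex.add_re] at e
      have := hT t ht
      simp only [Complex.sub_re, Complex.mul_re, Complex.re_ofNat, Complex.im_ofNat, zero_mul,
        sub_zero]
      linarith
  exact absurd ht (not_lt.2 (re_integral_conj_mul_nonneg fun z => u (t, z)))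

end Bound

/-! ### Translation between the stated definitions and directional derivatives. -/

section Conversion

variable {φ ψ : Space3 → ℂ} {u : ℝ × Space3 → ℂ}

theorem deriv_time_eq (hu : ContDiff ℝ ∞ u) (t : ℝ) (z : Space3) :
    deriv (fun τ : ℝ => u (τ, z)) t = pd timeVec u (t, z) :=
  (hasDerivAt_comp_curve hu ((hasDerivAt_id t).prodMk (hasDerivAt_const t z))).deriv

theorem iteratedDeriv_two_time_eq (hu : ContDiff ℝ ∞ u) (t : ℝ) (z : Space3) :
    iteratedDeriv 2 (fun τ : ℝ => u (τ, z)) t = pd timeVec (pd timeVec u) (t, z) := by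
  rw [iteratedDeriv_succ, iteratedDeriv_one]
  have : deriv (fun τ : ℝ => u (τ, z)) = fun τ => pd timeVec u (τ, z) :=
    funext fun τ => deriv_time_eq hu τ z
  rw [this, deriv_time_eq (hu.pd _)]

theorem laplacian_eq_sum_pd {f : Space3 → ℂ} (hf : ContDiff ℝ ∞ f) (z : Space3) :
    Laplacian.laplacian f z = ∑ i, pd (basisVec i) (pd (basisVec i) f) z := by
  rw [InnerProductSpace.laplacian_eq_iteratedFDeriv_orthonormalBasis f
    (EuclideanSpace.basisFun (Fin 3) ℝ)]
  refine Finset.sum_congr rfl fun i _ => ?_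
  rw [iteratedFDeriv_two_apply]
  have hd : Differentiable ℝ (fderiv ℝ f) :=
    (hf.fderiv_right (m := ∞) (by simp)).differentiable (by simp)
  change _ = fderiv ℝ (fun y => fderiv ℝ f y (basisVec i)) z (basisVec i)
  rw [fderiv_clm_apply (hd z) (differentiableAt_const _)]
  simp

theorem laplacian_slice_eq (hu : ContDiff ℝ ∞ u) (t : ℝ) (z : Space3) :
    Laplacian.laplacian (fun y : Space3 => u (t, y)) z =
      ∑ i, pd (spaceVec i) (pd (spaceVec i) u) (t, z) := by
  rw [laplacian_eq_sum_pd (contDiff_timeSlice hu t)]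
  refine Finset.sum_congr rfl fun i _ => ?_
  have e1 := pd_slice 0 hu t (basisVec i)
  have e2 := pd_slice 0 (hu.pd (spaceVec i)) t (basisVec i)
  simp only [zero_add] at e1 e2
  rw [e1, e2]

theorem isWaveSolution_iff : IsWaveSolution φ ψ u ↔
    IsSmoothWave u ∧ (∀ z, u (0, z) = φ z) ∧ ∀ z, pd timeVec u (0, z) = ψ z := by
  constructor
  · intro h
    refine ⟨⟨h.contDiff, fun p => ?_⟩, h.initial_value, fun z => ?_⟩
    · obtain ⟨t, z⟩ := p
      rw [← iteratedDeriv_two_time_eq h.contDiff, ← laplacian_slice_eq h.contDiff]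
      exact h.wave_eq t z
    · rw [← deriv_time_eq h.contDiff]
      exact h.initial_velocity z
  · rintro ⟨h, h0, h1⟩
    refine ⟨h.contDiff, fun t z => ?_, h0, fun z => ?_⟩
    · rw [iteratedDeriv_two_time_eq h.contDiff, laplacian_slice_eq h.contDiff]
      exact h.wave_eq (t, z)
    · rw [deriv_time_eq h.contDiff]
      exact h1 z

theorem isClassicalRadiationField_iff {G : ℝ × Sphere2 → ℂ} :
    IsClassicalRadiationField φ ψ G ↔ ∃ u, (IsSmoothWave u ∧ (∀ z, u (0, z) = φ z) ∧
      ∀ z, pd timeVec u (0, z) = ψ z) ∧ ∀ (s : ℝ) (θ : Sphere2),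
        Tendsto (fun r : ℝ => (r : ℂ) * pd timeVec u (s + r, r • (θ : Space3))) atTop
          (𝓝 (G (s, θ))) := by
  refine exists_congr fun u => ?_
  rw [isWaveSolution_iff]
  refine and_congr_right fun hu => ?_
  simp only [deriv_time_eq hu.1.contDiff]

end Conversion

/-! ### Radiation fields of test data. -/

section Classical

variable {φ ψ φ' ψ' : Space3 → ℂ} {G G' : ℝ × Sphere2 → ℂ}

theorem IsTestFunction.sub (h : IsTestFunction φ) (h' : IsTestFunction φ') :
    IsTestFunction (fun z => φ z - φ' z) :=
  ⟨h.1.sub h'.1, h.2.sub h'.2⟩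

theorem gradient3_sub (h : IsTestFunction φ) (h' : IsTestFunction φ') :
    gradient3 (fun z => φ z - φ' z) = fun z => gradient3 φ z - gradient3 φ' z := by
  funext z
  ext i
  exact congrFun (pd_sub h.1 h'.1 (basisVec i)) z

theorem IsTestFunction.continuous_gradient3 (h : IsTestFunction φ) : Continuous (gradient3 φ) := by
  have := h.1.continuous_fderiv (by simp)
  unfold gradient3
  fun_prop

theorem IsTestFunction.hasCompactSupport_gradient3 (h : IsTestFunction φ) :
    HasCompactSupport (gradient3 φ) := by
  refine h.2.fderiv (𝕜 := ℝ) |>.mono fun z hz hz' => hz ?_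
  ext i
  simp [gradient3, hz']

theorem IsClassicalRadiationField.sub (h : IsClassicalRadiationField φ ψ G)
    (h' : IsClassicalRadiationField φ' ψ' G') :
    IsClassicalRadiationField (fun z => φ z - φ' z) (fun z => ψ z - ψ' z)
      (fun p => G p - G' p) := by
  rw [isClassicalRadiationField_iff] at h h' ⊢
  obtain ⟨u, ⟨hu, h0, h1⟩, hG⟩ := h
  obtain ⟨u', ⟨hu', h0', h1'⟩, hG'⟩ := h'
  refine ⟨fun p => u p - u' p, ⟨hu.sub hu', fun z => by rw [← h0, ← h0'], fun z => ?_⟩, fun s θ => ?_⟩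
  · rw [pd_sub hu.contDiff hu'.contDiff, ← h1, ← h1']
  · rw [pd_sub hu.contDiff hu'.contDiff]
    simpa only [mul_sub] using (hG s θ).sub (hG' s θ)

theorem IsClassicalRadiationField.measurable (h : IsClassicalRadiationField φ ψ G) :
    Measurable G := by
  rw [isClassicalRadiationField_iff] at h
  obtain ⟨u, ⟨hu, -, -⟩, hG⟩ := h
  exact measurable_radiation (hu.contDiff.pd _).continuous hG

theorem eLpNorm_two_sq {α E : Type*} [MeasurableSpace α] [NormedAddCommGroup E] (f : α → E)
    (μ : Measure α) : eLpNorm f 2 μ ^ 2 = ∫⁻ x, ‖f x‖ₑ ^ 2 ∂μ := by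
  have h := eLpNorm_nnreal_pow_eq_lintegral (f := f) (μ := μ) (p := 2) two_ne_zero
  simpa only [ENNReal.coe_ofNat, NNReal.coe_ofNat, ENNReal.rpow_ofNat] using h

theorem EuclideanSpace.enorm_sq_eq_sum (x : EuclideanSpace ℂ (Fin 3)) :
    ‖x‖ₑ ^ 2 = ∑ i, ‖x i‖ₑ ^ 2 := by
  simp only [← ofReal_norm]
  rw [← ENNReal.ofReal_pow (norm_nonneg _), EuclideanSpace.norm_sq_eq,
    ENNReal.ofReal_sum_of_nonneg fun i _ => by positivity]
  exact Finset.sum_congr rfl fun i _ => ENNReal.ofReal_pow (norm_nonneg _) _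

/-- The constant `2` instead of `√2` is crude; only some finite constant matters. -/
theorem le_two_mul_of_sq_le {a b : ENNReal} (h : a ^ 2 ≤ 2 * b ^ 2) : a ≤ 2 * b := by
  rw [← ENNReal.pow_le_pow_left_iff two_ne_zero, mul_pow]
  refine h.trans ?_
  gcongr
  norm_num

/-- Applied to differences, this gives both uniqueness and the Cauchy property of approximations. -/
theorem IsClassicalRadiationField.eLpNorm_le (h : IsClassicalRadiationField φ ψ G)
    (hφ : IsTestFunction φ) (hψ : IsTestFunction ψ) :
    eLpNorm (gradient3 φ) 2 volume ≤ 2 * eLpNorm G 2 cylinderMeasure ∧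
      eLpNorm ψ 2 volume ≤ 2 * eLpNorm G 2 cylinderMeasure := by
  rw [isClassicalRadiationField_iff] at h
  obtain ⟨u, ⟨hu, h0, h1⟩, hG⟩ := h
  obtain ⟨a, ha⟩ := hφ.2.isCompact.isBounded.subset_closedBall 0
  obtain ⟨b, hb⟩ := hψ.2.isCompact.isBounded.subset_closedBall 0
  have hdata : DataSupportedIn (max a b) u := fun z hz => by
    rw [h0, h1]
    refine ⟨image_eq_zero_of_notMem_tsupport fun h => ?_,
      image_eq_zero_of_notMem_tsupport fun h => ?_⟩
    · have := ha h
      simp only [mem_closedBall_zero_iff] at this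
      exact absurd hz (not_lt.2 (this.trans (le_max_left _ _)))
    · have := hb h
      simp only [mem_closedBall_zero_iff] at this
      exact absurd hz (not_lt.2 (this.trans (le_max_right _ _)))
  have hE := hu.energy_le hdata hG
  have hgrad : ∫⁻ z, ‖gradient3 φ z‖ₑ ^ 2 = ∑ i, ∫⁻ z, ‖pd (spaceVec i) u (0, z)‖ₑ ^ 2 := by
    simp only [EuclideanSpace.enorm_sq_eq_sum]
    rw [lintegral_finsetSum']
    · refine Finset.sum_congr rfl fun i _ => lintegral_congr fun z => ?_
      have e := congrFun (pd_slice 0 hu.contDiff 0 (basisVec i)) z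
      simp only [zero_add, h0] at e
      rw [← e]
      rfl
    · intro i _
      have h2 : Continuous fun z => gradient3 φ z i := (hφ.1.pd (basisVec i)).continuous
      exact (h2.measurable.enorm.pow_const 2).aemeasurable
  simp only [h1] at hE
  rw [← hgrad, ← eLpNorm_two_sq, ← eLpNorm_two_sq, ← eLpNorm_two_sq] at hE
  exact ⟨le_two_mul_of_sq_le (le_add_self.trans hE), le_two_mul_of_sq_le (le_self_add.trans hE)⟩

end Classical

/-! ### Uniqueness of the data. -/

section Uniqueness

theorem ae_eq_of_tendsto_eLpNorm {α E : Type*} [MeasurableSpace α] [NormedAddCommGroup E]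
    {μ : Measure α} {A B : ℕ → α → E} {f g : α → E} (hA : ∀ n, AEStronglyMeasurable (A n) μ)
    (hB : ∀ n, AEStronglyMeasurable (B n) μ) (hf : AEStronglyMeasurable f μ)
    (hg : AEStronglyMeasurable g μ)
    (h1 : Tendsto (fun n => eLpNorm (fun x => A n x - f x) 2 μ) atTop (𝓝 0))
    (h2 : Tendsto (fun n => eLpNorm (fun x => B n x - g x) 2 μ) atTop (𝓝 0))
    (h3 : Tendsto (fun n => eLpNorm (fun x => A n x - B n x) 2 μ) atTop (𝓝 0)) : f =ᵐ[μ] g := by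
  have hle : ∀ n, eLpNorm (f - g) 2 μ ≤ eLpNorm (fun x => A n x - f x) 2 μ +
      eLpNorm (fun x => A n x - B n x) 2 μ + eLpNorm (fun x => B n x - g x) 2 μ := by
    intro n
    have e : f - g = ((fun x => A n x - B n x) - (fun x => A n x - f x)) +
        fun x => B n x - g x := by
      funext x
      simp
    rw [e]
    refine (eLpNorm_add_le (((hA n).sub (hB n)).sub ((hA n).sub hf)) ((hB n).sub hg)
      (by norm_num)).trans ?_
    refine add_le_add ?_ le_rfl
    refine (eLpNorm_sub_le ((hA n).sub (hB n)) ((hA n).sub hf) (by norm_num)).trans ?_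
    exact (add_comm _ _).le
  have hlim : Tendsto (fun n => eLpNorm (fun x => A n x - f x) 2 μ +
      eLpNorm (fun x => A n x - B n x) 2 μ + eLpNorm (fun x => B n x - g x) 2 μ) atTop (𝓝 0) := by
    simpa using (h1.add h3).add h2
  have h0 : eLpNorm (f - g) 2 μ = 0 := le_antisymm (ge_of_tendsto' hlim hle) zero_le
  have := (eLpNorm_eq_zero_iff (hf.sub hg) (by norm_num)).1 h0
  filter_upwards [this] with x hx
  exact sub_eq_zero.1 hx

/-- The derivative in `τ` is the pairing of `f` with minus `∂ₑ` of a translated test function, which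
vanishes. This allows a test function to be pushed off to infinity. -/
theorem integral_translate_eq {f : Space3 → ℂ} (hf : LocallyIntegrable f volume) {e : Space3}
    (h : ∀ χ : Space3 → ℂ, IsTestFunction χ → ∫ z, f z * pd e χ z = 0) {χ : Space3 → ℂ}
    (hχ : IsTestFunction χ) (τ : ℝ) : ∫ z, f z * χ (z - τ • e) = ∫ z, f z * χ z := by
  have htr : ∀ (g : Space3 → ℂ), IsTestFunction g → ∀ s : ℝ,
      IsTestFunction (fun z => g (z - s • e)) := fun g hg s =>
    ⟨hg.1.comp (by fun_prop), hg.2.comp_homeomorph (Homeomorph.subRight (s • e))⟩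
  have hpd : IsTestFunction (pd e χ) := ⟨hχ.1.pd e, hχ.2.pd e⟩
  have hint : ∀ (g : Space3 → ℂ), IsTestFunction g → Integrable (fun z => f z * g z) := fun g hg =>
    hf.integrable_smul_right_of_hasCompactSupport hg.1.continuous hg.2
  have hd : ∀ s : ℝ, HasDerivAt (fun s : ℝ => ∫ z, f z * χ (z - s • e)) 0 s := by
    intro s
    obtain ⟨M, hM⟩ := hpd.1.continuous.bounded_above_of_compact_support hpd.2
    obtain ⟨b, hb⟩ := hpd.2.isCompact.isBounded.subset_closedBall 0
    set K := Metric.closedBall (0 : Space3) (b + (|s| + 1) * ‖e‖) with hK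
    have hderiv := (hasDerivAt_integral_of_dominated_loc_of_deriv_le (μ := volume) (x₀ := s)
      (s := Metric.closedBall s 1)
      (F := fun (s : ℝ) z => f z * χ (z - s • e))
      (bound := K.indicator fun z => ‖f z‖ * M)
      (F' := fun (s : ℝ) z => f z * -pd e χ (z - s • e))
      (Metric.closedBall_mem_nhds s one_pos)
      (Eventually.of_forall fun r => (hint _ (htr χ hχ r)).aestronglyMeasurable)
      (hint _ (htr χ hχ s)) ?_ ?_ ?_ ?_).2
    · refine hderiv.congr_deriv ?_
      simp only [mul_neg, integral_neg, neg_eq_zero]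
      rw [← h _ (htr χ hχ s)]
      congr 1
      funext z
      congr 1
      have hs : HasFDerivAt (fun z : Space3 => z - s • e) (ContinuousLinearMap.id ℝ Space3) z :=
        (hasFDerivAt_id z).sub_const _
      rw [pd_comp hχ.1 hs]
      rfl
    · simp only [mul_neg]
      exact (hint _ (htr _ hpd s)).neg.aestronglyMeasurable
    · refine Eventually.of_forall fun z r hr => ?_
      by_cases hz : z ∈ K
      · rw [Set.indicator_of_mem hz, norm_mul, norm_neg]
        gcongr
        exact hM _
      · rw [Set.indicator_of_notMem hz]
        have h0 : pd e χ (z - r • e) = 0 := by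
          refine image_eq_zero_of_notMem_tsupport fun hmem => hz ?_
          have h1 : ‖z - r • e‖ ≤ b := by simpa using hb hmem
          have h2 : |r| ≤ |s| + 1 := by
            have : |r - s| ≤ 1 := by simpa [Real.dist_eq] using hr
            have := abs_sub_abs_le_abs_sub r s
            linarith
          have h3 : ‖z‖ ≤ ‖z - r • e‖ + ‖r • e‖ := by simpa using norm_add_le (z - r • e) (r • e)
          rw [norm_smul, Real.norm_eq_abs] at h3
          rw [hK, mem_closedBall_zero_iff]
          nlinarith [norm_nonneg e]
        simp [h0]
    · refine (integrable_indicator_iff Metric.isClosed_closedBall.measurableSet).2 ?_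
      exact ((hf.integrableOn_isCompact (isCompact_closedBall _ _)).norm.mul_const M)
    · refine Eventually.of_forall fun z r _ => ?_
      have hc : HasDerivAt (fun r : ℝ => z - r • e) (-e) r := by
        simpa using ((hasDerivAt_id r).smul_const e).const_sub z
      have := hasDerivAt_comp_curve hχ.1 hc
      rw [pd_neg_vec] at this
      exact this.const_mul (f z)
  have hconst := is_const_of_deriv_eq_zero (fun s => (hd s).differentiableAt)
    (fun s => (hd s).deriv) τ 0
  simpa using hconst

theorem eLpNorm_translate {χ : Space3 → ℂ} (hχ : Continuous χ) (w : Space3) (q : ENNReal) :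
    eLpNorm (fun z => χ (z - w)) q volume = eLpNorm χ q volume :=
  eLpNorm_comp_measurePreserving (g := χ) (f := fun z => z - w) hχ.aestronglyMeasurable
    (measurePreserving_sub_right volume w)

/-- The pairing of `f` with `χ` is unchanged when `χ` moves along `e`. Far out, `χ` sees only the
small `L⁶` tail of `f`, so the pairing is zero by Hölder's inequality. One direction suffices. -/
theorem ae_eq_zero_of_weak_deriv_eq_zero {f : Space3 → ℂ} (hf : MemLp f 6 volume) {e : Space3}
    (he : ‖e‖ = 1) (h : ∀ χ : Space3 → ℂ, IsTestFunction χ → ∫ z, f z * pd e χ z = 0) :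
    ∀ᵐ z, f z = 0 := by
  have hloc : LocallyIntegrable f volume := hf.locallyIntegrable (by norm_num)
  refine ae_eq_zero_of_integral_contDiff_smul_eq_zero hloc fun g hg hgc => ?_
  set χ : Space3 → ℂ := fun z => (g z : ℂ) with hχdef
  have hχ : IsTestFunction χ :=
    ⟨Complex.ofRealCLM.contDiff.comp hg, hgc.comp_left (g := fun x : ℝ => (x : ℂ)) (by simp)⟩
  have hgoal : ∫ z, g z • f z = ∫ z, f z * χ z := by
    simp only [hχdef, Complex.real_smul, mul_comm]
  rw [hgoal]
  set q := ENNReal.conjExponent 6 with hq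
  have hconj : ENNReal.HolderConjugate 6 q := ENNReal.HolderConjugate.conjExponent (by norm_num)
  have hχq : MemLp χ q volume := hχ.1.continuous.memLp_of_hasCompactSupport hχ.2
  have key : ∀ ε : ENNReal, ε ≠ 0 → ‖∫ z, f z * χ z‖ₑ ≤ ε * eLpNorm χ q volume := by
    intro ε hε
    obtain ⟨k, hkc, hk, hkcont, hkm⟩ := hf.exists_hasCompactSupport_eLpNorm_sub_le (by norm_num) hε
    obtain ⟨a, ha⟩ := hkc.isCompact.isBounded.subset_closedBall 0
    obtain ⟨b, hb⟩ := hχ.2.isCompact.isBounded.subset_closedBall 0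
    -- A shift long enough to separate the support of `χ` from that of the compactly supported
    -- approximation `k`.
    set τ : ℝ := |a| + |b| + 1 with hτ
    have hdisj : ∀ z, k z * χ (z - τ • e) = 0 := by
      intro z
      by_contra hne
      have h1 : ‖z‖ ≤ a := by
        simpa using ha (subset_tsupport k (left_ne_zero_of_mul hne))
      have h2 : ‖z - τ • e‖ ≤ b := by
        simpa using hb (subset_tsupport χ (right_ne_zero_of_mul hne))
      have h3 : ‖τ • e‖ ≤ ‖z‖ + ‖z - τ • e‖ := by
        simpa using norm_sub_le z (z - τ • e)
      rw [norm_smul, he, mul_one, Real.norm_of_nonneg (by positivity)] at h3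
      have := le_abs_self a
      have := le_abs_self b
      linarith
    rw [← integral_translate_eq hloc h hχ τ]
    set χτ : Space3 → ℂ := fun z => χ (z - τ • e) with hχτ
    have e1 : (fun z => f z * χ (z - τ • e)) = (f - k) • χτ := by
      funext z
      simp [hχτ, sub_mul, hdisj z]
    rw [e1]
    refine (enorm_integral_le_lintegral_enorm _).trans ?_
    rw [← eLpNorm_one_eq_lintegral_enorm]
    have hχm : Continuous χτ := hχ.1.continuous.comp (by fun_prop)
    have htr : eLpNorm χτ q volume = eLpNorm χ q volume :=
      eLpNorm_translate hχ.1.continuous _ q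
    refine (eLpNorm_smul_le_mul_eLpNorm (p := 6) (q := q) hχm.aestronglyMeasurable
      (hf.aestronglyMeasurable.sub hkm.aestronglyMeasurable)).trans ?_
    rw [htr]
    exact mul_le_mul_left hk _
  have hzero : ‖∫ z, f z * χ z‖ₑ ≤ 0 := by
    have hlim : Tendsto (fun n : ℕ => ((n : ENNReal)⁻¹) * eLpNorm χ q volume) atTop (𝓝 0) := by
      simpa using ENNReal.Tendsto.mul_const ENNReal.tendsto_inv_nat_nhds_zero
        (Or.inr hχq.eLpNorm_ne_top)
    exact ge_of_tendsto' hlim fun n => key _ (ENNReal.inv_ne_zero.2 (ENNReal.natCast_ne_top n))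
  simpa using hzero

theorem HasWeakGradient.ae_eq {φ φ' : Space3 → ℂ} {g g' : Space3 → EuclideanSpace ℂ (Fin 3)}
    (h : HasWeakGradient φ g) (h' : HasWeakGradient φ' g') (hg : g =ᵐ[volume] g')
    (hφ : MemLp φ 6 volume) (hφ' : MemLp φ' 6 volume) : φ =ᵐ[volume] φ' := by
  have hz := ae_eq_zero_of_weak_deriv_eq_zero (hφ.sub hφ') (e := basisVec 0) (by simp) ?_
  · filter_upwards [hz] with z hz
    exact sub_eq_zero.1 hz
  · intro χ hχ
    have e1 := h.integral_eq χ hχ 0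
    have e2 := h'.integral_eq χ hχ 0
    have e3 : ∫ z, g z 0 * χ z = ∫ z, g' z 0 * χ z := integral_congr_ae (by
      filter_upwards [hg] with z hz
      rw [hz])
    have hp : ∀ z, gradient3 χ z 0 = pd (basisVec 0) χ z := fun z => rfl
    simp only [hp] at e1 e2
    have i : ∀ {f : Space3 → ℂ}, LocallyIntegrable f volume →
        Integrable (fun z => f z * pd (basisVec 0) χ z) := fun hf =>
      hf.integrable_smul_right_of_hasCompactSupport (hχ.1.pd _).continuous (hχ.2.pd _)
    simp only [Pi.sub_apply, sub_mul]
    rw [integral_sub (i h.locallyIntegrable) (i h'.locallyIntegrable), e1, e2, e3, sub_self]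

/-- The two approximating sequences have fields with the same limit, so by the energy bound their
gradients and velocities have the same limits. -/
theorem IsRadiationField.ae_unique {φ ψ φ' ψ' : Space3 → ℂ} {G : ℝ × Sphere2 → ℂ}
    (h : IsRadiationField φ ψ G) (h' : IsRadiationField φ' ψ' G) :
    φ =ᵐ[volume] φ' ∧ ψ =ᵐ[volume] ψ' := by
  obtain ⟨⟨⟨hφ6, -⟩, hψ2⟩, hG, φn, ψn, Gn, ht, ⟨⟨g, hg, hg2, hgl⟩, hψl⟩, hc, hGl⟩ := h
  obtain ⟨⟨⟨hφ6', -⟩, hψ2'⟩, -, φn', ψn', Gn', ht', ⟨⟨g', hg', hg2', hgl'⟩, hψl'⟩, hc', hGl'⟩ := h'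
  have hdiff : Tendsto (fun n => 2 * eLpNorm (fun p => Gn n p - Gn' n p) 2 cylinderMeasure) atTop
      (𝓝 0) := by
    have hle : ∀ n, eLpNorm (fun p => Gn n p - Gn' n p) 2 cylinderMeasure ≤
        eLpNorm (fun p => Gn n p - G p) 2 cylinderMeasure +
          eLpNorm (fun p => Gn' n p - G p) 2 cylinderMeasure := by
      intro n
      have e : (fun p => Gn n p - Gn' n p) =
          (fun p => Gn n p - G p) - fun p => Gn' n p - G p := by
        funext p
        simp
      rw [e]
      exact eLpNorm_sub_le ((hc n).measurable.aestronglyMeasurable.sub hG.aestronglyMeasurable)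
        ((hc' n).measurable.aestronglyMeasurable.sub hG.aestronglyMeasurable) (by norm_num)
    have h0 := tendsto_of_tendsto_of_tendsto_of_le_of_le tendsto_const_nhds
      (by simpa using hGl.add hGl') (fun n => zero_le) hle
    simpa using ENNReal.Tendsto.const_mul h0 (Or.inr (by norm_num : (2 : ENNReal) ≠ ⊤))
  have hbd := fun n => ((hc n).sub (hc' n)).eLpNorm_le ((ht n).1.sub (ht' n).1)
    ((ht n).2.sub (ht' n).2)
  constructor
  · refine hg.ae_eq hg' ?_ hφ6 hφ6'
    refine ae_eq_of_tendsto_eLpNorm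
      (fun n => (ht n).1.continuous_gradient3.aestronglyMeasurable)
      (fun n => (ht' n).1.continuous_gradient3.aestronglyMeasurable)
      hg2.aestronglyMeasurable hg2'.aestronglyMeasurable hgl hgl' ?_
    refine tendsto_of_tendsto_of_tendsto_of_le_of_le tendsto_const_nhds hdiff
      (fun n => zero_le) fun n => ?_
    have := (hbd n).1
    rwa [gradient3_sub (ht n).1 (ht' n).1] at this
  · refine ae_eq_of_tendsto_eLpNorm
      (fun n => (ht n).2.1.continuous.aestronglyMeasurable)
      (fun n => (ht' n).2.1.continuous.aestronglyMeasurable)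
      hψ2.aestronglyMeasurable hψ2'.aestronglyMeasurable hψl hψl' ?_
    exact tendsto_of_tendsto_of_tendsto_of_le_of_le tendsto_const_nhds hdiff
      (fun n => zero_le) fun n => (hbd n).2

end Uniqueness

/-! ### Superpositions of plane waves. -/

section PlaneWaves

/-- Superposition of plane waves with profile `K` and angular density `c`. -/
noncomputable def planeWaves (c : Space3 → ℂ) (K : ℝ → ℂ) (p : ℝ × Space3) : ℂ :=
  ∫ θ : Sphere2, c θ * K (p.1 + inner ℝ p.2 (θ : Space3)) ∂surf

variable {c : Space3 → ℂ} {K : ℝ → ℂ}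

theorem pd_const_mul {V : Type*} [NormedAddCommGroup V] [NormedSpace ℝ V] {f : V → ℂ}
    (hf : ContDiff ℝ ∞ f) (b : ℂ) (v : V) : pd v (fun x => b * f x) = fun x => b * pd v f x := by
  funext x
  simp only [pd]
  rw [fderiv_const_mul ((hf.differentiable (by simp)) x)]
  simp

theorem contDiff_phase :
    ContDiff ℝ ∞ (fun q : (ℝ × Space3) × Space3 => q.1.1 + inner ℝ q.1.2 q.2) :=
  contDiff_fst.fst.add (contDiff_fst.snd.inner ℝ contDiff_snd)

theorem contDiff_planeWave (hK : ContDiff ℝ ∞ K) (e : Space3) :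
    ContDiff ℝ ∞ (fun p : ℝ × Space3 => K (p.1 + inner ℝ p.2 e)) :=
  hK.comp (contDiff_phase.comp (contDiff_id.prodMk contDiff_const))

theorem contDiff_planeWave_integrand (hc : ContDiff ℝ ∞ c) (hK : ContDiff ℝ ∞ K) :
    ContDiff ℝ ∞ (fun q : (ℝ × Space3) × Space3 => c q.2 * K (q.1.1 + inner ℝ q.1.2 q.2)) :=
  (hc.comp contDiff_snd).mul (hK.comp contDiff_phase)

theorem contDiff_planeWaves (hc : ContDiff ℝ ∞ c) (hK : ContDiff ℝ ∞ K) :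
    ContDiff ℝ ∞ (planeWaves c K) :=
  contDiff_sphere_integral (contDiff_planeWave_integrand hc hK)

theorem hasDerivAt_profile (hK : ContDiff ℝ ∞ K) (p v : ℝ × Space3) (y : Space3) :
    HasDerivAt (fun s : ℝ => K ((p + s • v).1 + inner ℝ (p + s • v).2 y))
      ((v.1 + inner ℝ v.2 y : ℝ) * deriv K (p.1 + inner ℝ p.2 y)) 0 := by
  have h1 : HasDerivAt (fun s : ℝ => (p + s • v).1 + inner ℝ (p + s • v).2 y)
      (v.1 + inner ℝ v.2 y) 0 := by
    have e : (fun s : ℝ => (p + s • v).1 + inner ℝ (p + s • v).2 y) =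
        fun s : ℝ => (p.1 + inner ℝ p.2 y) + s * (v.1 + inner ℝ v.2 y) := by
      funext s
      simp [inner_add_left, inner_smul_left]
      ring
    rw [e]
    simpa using ((hasDerivAt_id (0 : ℝ)).mul_const (v.1 + inner ℝ v.2 y)).const_add
      (p.1 + inner ℝ p.2 y)
  have h2 : HasDerivAt K (deriv K (p.1 + inner ℝ p.2 y))
      ((p + (0 : ℝ) • v).1 + inner ℝ (p + (0 : ℝ) • v).2 y) := by
    simpa using ((hK.differentiable (by simp)) (p.1 + inner ℝ p.2 y)).hasDerivAt
  have h3 := h2.scomp (0 : ℝ) h1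
  simpa [Function.comp_def] using h3

theorem hasDerivAt_line {V : Type*} [NormedAddCommGroup V] [NormedSpace ℝ V] {f : V → ℂ}
    (hf : ContDiff ℝ ∞ f) (p v : V) : HasDerivAt (fun s : ℝ => f (p + s • v)) (pd v f p) 0 := by
  have h : HasDerivAt (fun s : ℝ => p + s • v) v 0 := by
    simpa using ((hasDerivAt_id (0 : ℝ)).smul_const v).const_add p
  simpa using hasDerivAt_comp_curve hf h

/-- Each derivative multiplies the density by a linear factor. This is why a general density `c` is
carried along, although the radial wave has a constant one. -/
theorem pd_planeWaves (hc : ContDiff ℝ ∞ c) (hK : ContDiff ℝ ∞ K) (v : ℝ × Space3) :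
    pd v (planeWaves c K) =
      planeWaves (fun y => c y * (v.1 + inner ℝ v.2 y : ℝ)) (deriv K) := by
  have hf := contDiff_planeWave_integrand hc hK
  refine (pd_sphere_integral hf v).trans (funext fun p => integral_congr_ae
    (Eventually.of_forall fun θ => ?_))
  have h1 := hasDerivAt_line hf (p, (θ : Space3)) (v, 0)
  have h2 := (hasDerivAt_profile hK p v θ).const_mul (c θ)
  refine (h1.unique (h2.congr_of_eventuallyEq (Eventually.of_forall fun s => ?_))).trans ?_
  · simp
  · beta_reduce
    ring

theorem isSmoothWave_planeWaves (hc : ContDiff ℝ ∞ c) (hK : ContDiff ℝ ∞ K) :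
    IsSmoothWave (planeWaves c K) where
  contDiff := contDiff_planeWaves hc hK
  wave_eq p := by
    have hK1 : ContDiff ℝ ∞ (deriv K) := (contDiff_infty_iff_deriv.1 hK).2
    have hK2 : ContDiff ℝ ∞ (deriv (deriv K)) := (contDiff_infty_iff_deriv.1 hK1).2
    have hof : ContDiff ℝ ∞ (fun r : ℝ => (r : ℂ)) := Complex.ofRealCLM.contDiff
    have hc1 : ∀ v : ℝ × Space3, ContDiff ℝ ∞ (fun y => c y * (v.1 + inner ℝ v.2 y : ℝ)) :=
      fun v => hc.mul (hof.comp (contDiff_phase.comp (contDiff_const.prodMk contDiff_id)))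
    have h2 : ∀ v : ℝ × Space3, pd v (pd v (planeWaves c K)) =
        planeWaves (fun y => c y * (v.1 + inner ℝ v.2 y : ℝ) * (v.1 + inner ℝ v.2 y : ℝ))
          (deriv (deriv K)) := fun v => by
      rw [pd_planeWaves hc hK, pd_planeWaves (hc1 v) hK1]
    simp only [h2, planeWaves]
    rw [← integral_finsetSum]
    · refine integral_congr_ae (Eventually.of_forall fun θ => ?_)
      have hθ : ∑ i, ((θ : Space3) i : ℂ) * ((θ : Space3) i : ℂ) = 1 := by
        have h := EuclideanSpace.real_norm_sq_eq (θ : Space3)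
        rw [norm_eq_of_mem_sphere, one_pow] at h
        have h' := congrArg (fun x : ℝ => (x : ℂ)) h
        simp only [Complex.ofReal_one, Complex.ofReal_sum, Complex.ofReal_pow] at h'
        rw [h']
        exact Finset.sum_congr rfl fun i _ => by ring
      have hi : ∀ i, inner ℝ (basisVec i) (θ : Space3) = (θ : Space3) i := fun i => by
        rw [EuclideanSpace.inner_single_left]
        simp
      simp only [inner_zero_left, add_zero, zero_add, hi, Complex.ofReal_one, mul_one]
      rw [← Finset.sum_mul]
      congr 1
      simp only [mul_assoc]
      rw [← Finset.mul_sum, hθ, mul_one]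
    · intro i _
      have hcc := hc.continuous
      have hKc := hK2.continuous
      exact Continuous.integrable_surf (by fun_prop)

theorem isSmoothWave_planeWave (hK : ContDiff ℝ ∞ K) {e : Space3} (he : ‖e‖ = 1) :
    IsSmoothWave (fun p => K (p.1 + inner ℝ p.2 e)) where
  contDiff := contDiff_planeWave hK e
  wave_eq p := by
    have hK1 : ContDiff ℝ ∞ (deriv K) := (contDiff_infty_iff_deriv.1 hK).2
    have h1 : ∀ {K : ℝ → ℂ}, ContDiff ℝ ∞ K → ∀ v : ℝ × Space3,
        pd v (fun p : ℝ × Space3 => K (p.1 + inner ℝ p.2 e)) =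
          fun p => (v.1 + inner ℝ v.2 e : ℝ) * deriv K (p.1 + inner ℝ p.2 e) := fun hK v =>
      funext fun p => (hasDerivAt_line (contDiff_planeWave hK e) p v).unique (hasDerivAt_profile hK p v e)
    have h2 : ∀ v : ℝ × Space3, pd v (pd v (fun p : ℝ × Space3 => K (p.1 + inner ℝ p.2 e))) =
        fun p => (v.1 + inner ℝ v.2 e : ℝ) * ((v.1 + inner ℝ v.2 e : ℝ) *
          deriv (deriv K) (p.1 + inner ℝ p.2 e)) := fun v => by
      rw [h1 hK]
      rw [pd_const_mul (contDiff_planeWave hK1 e), h1 hK1]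
    simp only [h2]
    have hθ : ∑ i, (e i : ℂ) * (e i : ℂ) = 1 := by
      have h := EuclideanSpace.real_norm_sq_eq e
      rw [he, one_pow] at h
      have h' := congrArg (fun x : ℝ => (x : ℂ)) h
      simp only [Complex.ofReal_one, Complex.ofReal_sum, Complex.ofReal_pow] at h'
      rw [h']
      exact Finset.sum_congr rfl fun i _ => by ring
    have hi : ∀ i, inner ℝ (basisVec i) e = e i := fun i => by
      rw [EuclideanSpace.inner_single_left]
      simp
    simp only [inner_zero_left, add_zero, zero_add, hi, Complex.ofReal_one, one_mul, ← mul_assoc]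
    rw [← Finset.sum_mul, hθ, one_mul]

/-- Archimedes' formula for the integral over the sphere of a function of one coordinate. -/
theorem mul_planeWaves_one (hK : ContDiff ℝ ∞ K) {g : ℝ → ℂ} (hg : ∀ s, HasDerivAt g (K s) s)
    {e : Space3} (he : ‖e‖ = 1) (t : ℝ) {r : ℝ} (hr : 0 ≤ r) :
    r * planeWaves (fun _ => 1) K (t, r • e) =
      (surf.real Set.univ : ℂ) / 2 * (g (t + r) - g (t - r)) := by
  have hv := isSmoothWave_planeWave hK he
  set v : ℝ × Space3 → ℂ := fun p => K (p.1 + inner ℝ p.2 e) with hvdef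
  set m := timeSphereMean v 0 with hm
  have hms : ContDiff ℝ ∞ m := contDiff_timeSphereMean 0 hv.contDiff
  set a := t - r with ha
  set κ : ℂ := (surf.real Set.univ : ℂ) with hκ
  -- Along the outgoing ray `t - r = a`, the derivative of `r m` is the left side of Kirchhoff's
  -- identity for one plane wave about the origin, hence `κ K(a + 2x)`. Integration produces the
  -- primitive `g`.
  have hd : ∀ x : ℝ, 0 ≤ x → HasDerivAt
      (fun x : ℝ => (x : ℂ) * m (a + x, x) - κ / 2 * g (a + 2 * x)) 0 x := by
    intro x hx
    have hof : HasDerivAt (fun s : ℝ => (s : ℂ)) 1 x := Complex.ofRealCLM.hasDerivAt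
    have hγ : HasDerivAt (fun s : ℝ => (a + s, s)) ((1 : ℝ), (1 : ℝ)) x :=
      ((hasDerivAt_id x).const_add a).prodMk (hasDerivAt_id x)
    have hl : HasDerivAt (fun s : ℝ => a + 2 * s) 2 x := by
      simpa using ((hasDerivAt_id x).const_mul 2).const_add a
    have hgl := (hg (a + 2 * x)).scomp x hl
    have d := (hof.mul (hasDerivAt_comp_curve hms hγ)).sub (hgl.const_mul (κ / 2))
    refine d.congr_deriv ?_
    have hk := hv.kirchhoff_mean 0 (a + 2 * x) hx
    have e1 : a + 2 * x - x = a + x := by ring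
    rw [e1, ← hm, ← hκ] at hk
    have e2 : v (a + 2 * x, 0) = K (a + 2 * x) := by simp [hvdef]
    rw [e2] at hk
    have e3 : pd (1, 1) m (a + x, x) = pd (1, 0) m (a + x, x) + pd (0, 1) m (a + x, x) := by
      simp only [pd]
      rw [← map_add]
      simp
    rw [e3]
    simp only [Complex.real_smul, Complex.ofReal_ofNat]
    linear_combination hk
  have hconst := constant_of_has_deriv_right_zero (a := 0) (b := r)
    (fun s hs => (hd s hs.1).continuousAt.continuousWithinAt)
    (fun s hs => (hd s hs.1).hasDerivWithinAt) r ⟨hr, le_rfl⟩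
  -- Symmetry of the inner product turns the mean of one plane wave over the sphere into the
  -- superposition evaluated at `r e`; rotation invariance is not needed.
  have e4 : m (a + r, r) = planeWaves (fun _ => 1) K (t, r • e) := by
    simp only [hm, timeSphereMean, planeWaves, hvdef, ha, one_mul]
    refine integral_congr_ae (Eventually.of_forall fun θ => ?_)
    simp [inner_smul_left, real_inner_comm]
  have e5 : a + 2 * r = t + r := by rw [ha]; ring
  simp only [e4, e5, Complex.ofReal_zero, zero_mul, mul_zero, add_zero, zero_sub] at hconst
  linear_combination hconst

end PlaneWaves

/-! ### Radial waves with prescribed radiation field. -/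

section RadialWaves

/-- The radial wave whose forward radiation field is `K`. -/
noncomputable def radialWave (K : ℝ → ℂ) (p : ℝ × Space3) : ℂ :=
  -(2 / (surf.real Set.univ : ℂ)) * planeWaves (fun _ => 1) K p

variable {K g : ℝ → ℂ}

theorem isSmoothWave_radialWave (hK : ContDiff ℝ ∞ K) : IsSmoothWave (radialWave K) where
  contDiff := contDiff_const.mul (contDiff_planeWaves contDiff_const hK)
  wave_eq p := by
    have h := isSmoothWave_planeWaves (c := fun _ => 1) contDiff_const hK
    unfold radialWave
    simp only [pd_const_mul h.contDiff, pd_const_mul (h.contDiff.pd _), h.wave_eq,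
      Finset.mul_sum]

/-- The velocity is thus a radial wave whose profile `K'` has the primitive `K`, so one argument
treats both data. -/
theorem pd_time_radialWave (hK : ContDiff ℝ ∞ K) :
    pd timeVec (radialWave K) = radialWave (deriv K) := by
  unfold radialWave
  rw [pd_const_mul (contDiff_planeWaves contDiff_const hK), pd_planeWaves contDiff_const hK]
  simp

theorem mul_radialWave (hK : ContDiff ℝ ∞ K) (hg : ∀ s, HasDerivAt g (K s) s)
    {e : Space3} (he : ‖e‖ = 1) (t : ℝ) {r : ℝ} (hr : 0 ≤ r) :
    r * radialWave K (t, r • e) = -(g (t + r) - g (t - r)) := by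
  have h := mul_planeWaves_one hK hg he t hr
  have hκ : (surf.real Set.univ : ℂ) ≠ 0 := by exact_mod_cast surf_real_univ_pos.ne'
  rw [radialWave, mul_left_comm, h]
  field_simp

theorem radialWave_eq (hK : ContDiff ℝ ∞ K) (hg : ∀ s, HasDerivAt g (K s) s) (t : ℝ) {z : Space3}
    (hz : z ≠ 0) : radialWave K (t, z) = -(g (t + ‖z‖) - g (t - ‖z‖)) / ‖z‖ := by
  have hn : ‖z‖ ≠ 0 := norm_ne_zero_iff.2 hz
  have h := mul_radialWave hK hg (e := ‖z‖⁻¹ • z)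
    (by rw [norm_smul, norm_inv, norm_norm, inv_mul_cancel₀ hn]) t (norm_nonneg z)
  rw [smul_inv_smul₀ hn] at h
  rw [← h, mul_div_cancel_left₀]
  exact_mod_cast hn

/-- Radial test data with a prescribed radiation field. -/
theorem exists_radial_data {b : ℝ} (hK : ContDiff ℝ ∞ K) (hb : ∀ s, b < |s| → K s = 0)
    (hmean : ∫ s, K s = 0) : ∃ φ ψ : Space3 → ℂ, IsTestFunction φ ∧ IsTestFunction ψ ∧
      IsClassicalRadiationField φ ψ (fun p => K p.1) ∧ IsRadial φ ∧ IsRadial ψ ∧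
      (∀ z, b < ‖z‖ → φ z = 0) ∧ ∀ z, b < ‖z‖ → ψ z = 0 := by
  have hKi : Integrable K := by
    refine hK.continuous.integrable_of_hasCompactSupport
      (HasCompactSupport.of_support_subset_isCompact (isCompact_Icc (a := -b) (b := b)) ?_)
    intro s hs
    by_contra hcon
    refine hs (hb s ?_)
    by_contra hle
    exact hcon (abs_le.1 (not_lt.1 hle))
  set g : ℝ → ℂ := fun s => ∫ x in Set.Iic s, K x with hgdef
  have hg : ∀ s, HasDerivAt g (K s) s := by
    intro s
    have h1 : ∀ x, g x = g 0 + ∫ y in (0 : ℝ)..x, K y := fun x => by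
      rw [← intervalIntegral.integral_Iic_sub_Iic hKi.integrableOn hKi.integrableOn]
      simp [hgdef]
    have h2 := (hK.continuous.integral_hasStrictDerivAt 0 s).hasDerivAt.const_add (g 0)
    rwa [← show g = fun x => g 0 + ∫ y in (0 : ℝ)..x, K y from funext h1] at h2
  -- To the right of the support of `K`, the primitive equals the full integral; the mean-zero
  -- condition enters here.
  have hg0 : ∀ s, b < |s| → g s = 0 := by
    intro s hs
    rcases le_total s 0 with h0 | h0
    · refine setIntegral_eq_zero_of_forall_eq_zero fun x hx => hb x ?_
      have hx' : x ≤ s := hx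
      rw [abs_of_nonpos h0] at hs
      rw [abs_of_nonpos (hx'.trans h0)]
      linarith
    · have h1 : ∫ x in Set.Ioi s, K x = 0 := by
        refine setIntegral_eq_zero_of_forall_eq_zero fun x hx => hb x ?_
        have hx' : s < x := hx
        rw [abs_of_nonneg h0] at hs
        rw [abs_of_nonneg (h0.trans hx'.le)]
        linarith
      have h2 := intervalIntegral.integral_Iic_add_Ioi (b := s) hKi.integrableOn hKi.integrableOn
      rw [h1, add_zero, hmean] at h2
      exact h2
  have hK1 : ContDiff ℝ ∞ (deriv K) := (contDiff_infty_iff_deriv.1 hK).2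
  have hKd : ∀ s, HasDerivAt K (deriv K s) s := fun s =>
    ((hK.differentiable (by simp)) s).hasDerivAt
  have hwave := isSmoothWave_radialWave hK
  have data : ∀ {L h : ℝ → ℂ}, ContDiff ℝ ∞ L → (∀ s, HasDerivAt h (L s) s) →
      (∀ s, b < |s| → h s = 0) →
      IsTestFunction (fun z => radialWave L (0, z)) ∧ IsRadial (fun z => radialWave L (0, z)) ∧
      ∀ z, b < ‖z‖ → radialWave L (0, z) = 0 := by
    intro L h hL hh h0
    have hne : ∀ᵐ z : Space3, z ≠ 0 := by simp [ae_iff]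
    have hzero : ∀ z : Space3, z ≠ 0 → b < ‖z‖ → radialWave L (0, z) = 0 := by
      intro z hz0 hz
      rw [radialWave_eq hL hh 0 hz0, zero_add, zero_sub, h0 _ (by rwa [abs_norm]),
        h0 _ (by rwa [abs_neg, abs_norm])]
      simp
    have hcont := contDiff_timeSlice (isSmoothWave_radialWave hL).contDiff 0
    -- The explicit formula excludes the origin, which `b < ‖z‖` admits when `b < 0`; continuity
    -- covers it.
    have hzero' : ∀ z : Space3, b < ‖z‖ → radialWave L (0, z) = 0 := by
      have hEq := Measure.eqOn_open_of_ae_eq (μ := (volume : Measure Space3))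
        (f := fun z => radialWave L (0, z)) (g := fun _ => 0) (U := {z | b < ‖z‖}) ?_
        (isOpen_lt continuous_const continuous_norm) hcont.continuous.continuousOn
        continuousOn_const
      · exact fun z hz => hEq hz
      · refine (ae_restrict_iff' (isOpen_lt continuous_const continuous_norm).measurableSet).2 ?_
        filter_upwards [hne] with z hz hzb
        exact hzero z hz hzb
    refine ⟨⟨hcont, hasCompactSupport_of_eq_zero hzero'⟩,
      ⟨fun r => -(h r - h (-r)) / r, ?_⟩, hzero'⟩
    filter_upwards [hne] with z hz
    rw [radialWave_eq hL hh 0 hz, zero_add, zero_sub]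
  obtain ⟨t0, r0, z0⟩ := data hK hg hg0
  obtain ⟨t1, r1, z1⟩ := data hK1 hKd hb
  refine ⟨fun z => radialWave K (0, z), fun z => radialWave (deriv K) (0, z), t0, t1, ?_, r0, r1,
    z0, z1⟩
  rw [isClassicalRadiationField_iff]
  refine ⟨radialWave K, ⟨hwave, fun z => rfl, fun z => by rw [pd_time_radialWave hK]⟩,
    fun s θ => ?_⟩
  rw [pd_time_radialWave hK]
  refine tendsto_const_nhds.congr' ?_
  -- For such `r` the incoming argument `s + 2r` has left the support of `K`, so the limit is
  -- attained.
  filter_upwards [eventually_ge_atTop (|s| + |b| + 1)] with r hr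
  have hr0 : 0 ≤ r := le_trans (by positivity) hr
  rw [mul_radialWave hK1 hKd (norm_eq_of_mem_sphere θ) _ hr0, hb (s + r + r) ?_]
  · simp
  · have h1 := neg_abs_le s
    have h2 := le_abs_self b
    have h3 := abs_nonneg s
    have h4 := abs_nonneg b
    exact lt_of_lt_of_le (by linarith) (le_abs_self _)

end RadialWaves

/-! ### Smooth mean-zero approximation. -/

section Approximation

theorem enorm_setIntegral_le_eLpNorm_two {f : ℝ → ℂ} {K : Set ℝ}
    (hf : AEStronglyMeasurable f volume) :
    ‖∫ s in K, f s‖ₑ ≤ eLpNorm f 2 volume * volume K ^ (1 / 2 : ℝ) := by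
  refine (enorm_integral_le_lintegral_enorm _).trans ?_
  rw [← eLpNorm_one_eq_lintegral_enorm]
  have h := eLpNorm_le_eLpNorm_mul_rpow_measure_univ (p := 1) (q := 2)
    (μ := volume.restrict K) (by norm_num) hf.restrict
  rw [Measure.restrict_apply_univ] at h
  have e : (1 / (1 : ENNReal).toReal - 1 / (2 : ENNReal).toReal : ℝ) = 1 / 2 := by norm_num
  rw [e] at h
  exact h.trans (by gcongr; exact Measure.restrict_le_self)

/-- `L²` functions of mean zero are limits of smooth functions of mean zero with almost the same
support. -/
theorem exists_smooth_approx {F : ℝ → ℂ} (hF : MemLp F 2 volume) {R δ : ℝ} (hR : 0 ≤ R)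
    (hδ : 0 < δ) (hsupp : ∀ᵐ s : ℝ, R < |s| → F s = 0) (hmean : ∫ s, F s = 0) {ε : ENNReal}
    (hε : 0 < ε) : ∃ H : ℝ → ℂ, ContDiff ℝ ∞ H ∧ (∀ s, R + δ < |s| → H s = 0) ∧
      ∫ s, H s = 0 ∧ eLpNorm (fun s => H s - F s) 2 volume ≤ ε := by
  -- The cutoff is `1` on a neighbourhood of the support of `F`, so multiplying by it does not
  -- increase the error.
  let η : ContDiffBump (0 : ℝ) := ⟨R + δ / 2, R + δ, by linarith, by linarith⟩
  set K : Set ℝ := Metric.closedBall 0 (R + δ) with hK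
  have hη0 : ∀ s, s ∉ K → η s = 0 := fun s hs => η.zero_of_le_dist (by
    have : ¬ dist s 0 ≤ R + δ := hs
    exact (not_le.1 this).le)
  set ρ : ℝ → ℂ := fun s => ((η.normed volume s : ℝ) : ℂ) with hρ
  have hρs : ContDiff ℝ ∞ ρ := Complex.ofRealCLM.contDiff.comp η.contDiff_normed
  have hρc : HasCompactSupport ρ := η.hasCompactSupport_normed.comp_left
    (g := fun x : ℝ => (x : ℂ)) (by simp)
  have hρ1 : ∫ s, ρ s = 1 := by
    simp only [hρ]
    rw [integral_complex_ofReal, η.integral_normed, Complex.ofReal_one]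
  have hρ2 : MemLp ρ 2 volume := hρs.continuous.memLp_of_hasCompactSupport hρc
  have hρ0 : ∀ s, s ∉ K → ρ s = 0 := fun s hs => by
    simp [hρ, ContDiffBump.normed, hη0 s hs]
  have hKv : volume K ≠ ⊤ := (isCompact_closedBall _ _).measure_lt_top.ne
  have hF0 : ∀ᵐ s : ℝ, s ∉ Metric.closedBall (0 : ℝ) (R + δ / 2) → F s = 0 := by
    filter_upwards [hsupp] with s hs hsn
    refine hs ?_
    have : R + δ / 2 < |s| := by simpa using hsn
    linarith
  have hFK : ∀ᵐ s : ℝ, s ∉ K → F s = 0 := by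
    filter_upwards [hF0] with s hs hsn
    exact hs fun h => hsn (Metric.closedBall_subset_closedBall (by linarith) h)
  have hFi : Integrable F := by
    have h1 : IntegrableOn F K := by
      have : IsFiniteMeasure (volume.restrict K) := ⟨by
        rw [Measure.restrict_apply_univ]; exact hKv.lt_top⟩
      exact (hF.restrict K).integrable (by norm_num)
    refine h1.integrable_of_ae_notMem_eq_zero hFK
  have hηF : ∀ᵐ s : ℝ, (η s : ℂ) * F s = F s := by
    filter_upwards [hF0] with s hs
    by_cases h : s ∈ Metric.closedBall (0 : ℝ) (R + δ / 2)
    · rw [η.one_of_mem_closedBall h, Complex.ofReal_one, one_mul]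
    · rw [hs h, mul_zero]
  have key : ∀ ε' : ENNReal, ε' ≠ 0 → ∃ H : ℝ → ℂ, ContDiff ℝ ∞ H ∧
      (∀ s, R + δ < |s| → H s = 0) ∧ ∫ s, H s = 0 ∧
      eLpNorm (fun s => H s - F s) 2 volume ≤
        ε' + ε' * volume K ^ (1 / 2 : ℝ) * eLpNorm ρ 2 volume := by
    intro ε' hε'
    obtain ⟨e, he0, he⟩ : ∃ e : ℝ, 0 < e ∧ ENNReal.ofReal e ≤ ε' := by
      rcases eq_or_ne ε' ⊤ with rfl | ht
      · exact ⟨1, one_pos, le_top⟩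
      · exact ⟨ε'.toReal, ENNReal.toReal_pos hε' ht, (ENNReal.ofReal_toReal ht).le⟩
    obtain ⟨k, hkc, hk, hkF⟩ := hF.exist_eLpNorm_sub_le (by norm_num) (by norm_num) he0
    set w : ℝ → ℂ := fun s => (η s : ℂ) * k s with hw
    have hws : ContDiff ℝ ∞ w := (Complex.ofRealCLM.contDiff.comp η.contDiff).mul hk
    have hwc : HasCompactSupport w := hkc.mul_left
    have hw0 : ∀ s, s ∉ K → w s = 0 := fun s hs => by simp [hw, hη0 s hs]
    have hwi : Integrable w := hws.continuous.integrable_of_hasCompactSupport hwc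
    have hwF : eLpNorm (fun s => w s - F s) 2 volume ≤ ε' := by
      refine le_trans ?_ (hkF.trans he)
      rw [eLpNorm_sub_comm F k]
      refine eLpNorm_mono_ae ?_
      filter_upwards [hηF] with s hs
      have e : w s - F s = (η s : ℂ) * (k s - F s) := by rw [mul_sub, hs]
      rw [e, norm_mul, Complex.norm_real, Real.norm_of_nonneg η.nonneg]
      exact mul_le_of_le_one_left (norm_nonneg _) η.le_one
    -- Subtracting `b ρ`, where `ρ` has integral `1`, restores mean zero. As `∫ F = 0`, the number
    -- `b` is the integral of the error over `K` and is small by Cauchy–Schwarz.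
    set b : ℂ := ∫ s, w s with hb
    have hbn : ‖b‖ₑ ≤ ε' * volume K ^ (1 / 2 : ℝ) := by
      have e1 : b = ∫ s in K, (w s - F s) := by
        rw [setIntegral_eq_integral_of_ae_compl_eq_zero, integral_sub hwi hFi, hmean, sub_zero]
        filter_upwards [hFK] with s hs hsn
        rw [hs hsn, hw0 s hsn, sub_zero]
      rw [e1]
      refine (enorm_setIntegral_le_eLpNorm_two
        (hwi.aestronglyMeasurable.sub hF.aestronglyMeasurable)).trans ?_
      exact mul_le_mul_left hwF _
    refine ⟨fun s => w s - b * ρ s, hws.sub (contDiff_const.mul hρs), fun s hs => ?_, ?_, ?_⟩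
    · have hsn : s ∉ K := by simpa [hK] using hs
      beta_reduce
      rw [hw0 s hsn, hρ0 s hsn, mul_zero, sub_zero]
    · rw [integral_sub hwi ((hρs.continuous.integrable_of_hasCompactSupport hρc).const_mul b),
        integral_const_mul, hρ1, mul_one, sub_self]
    · have e2 : (fun s => w s - b * ρ s - F s) = (fun s => w s - F s) - b • ρ := by
        funext s
        simp
        ring
      rw [e2]
      refine (eLpNorm_sub_le (hwi.aestronglyMeasurable.sub hF.aestronglyMeasurable)
        (hρ2.aestronglyMeasurable.const_smul b) (by norm_num)).trans ?_
      rw [eLpNorm_const_smul]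
      exact add_le_add hwF (mul_le_mul_left hbn _)
  set M : ENNReal := 1 + volume K ^ (1 / 2 : ℝ) * eLpNorm ρ 2 volume with hM
  have hMt : M ≠ ⊤ := ENNReal.add_ne_top.2 ⟨ENNReal.one_ne_top, ENNReal.mul_ne_top
    (ENNReal.rpow_ne_top_of_nonneg (by norm_num) hKv) hρ2.eLpNorm_ne_top⟩
  have hM0 : M ≠ 0 := by simp [hM]
  obtain ⟨H, h1, h2, h3, h4⟩ := key (ε / M) (ENNReal.div_ne_zero.2 ⟨hε.ne', hMt⟩)
  refine ⟨H, h1, h2, h3, h4.trans ?_⟩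
  have e : ε / M + ε / M * volume K ^ (1 / 2 : ℝ) * eLpNorm ρ 2 volume = ε / M * M := by
    rw [hM, mul_add, mul_one, mul_assoc]
  rw [e, ENNReal.div_mul_cancel hM0 hMt]

end Approximation

/-! ### Properties inherited by limits. -/

section Limits

variable {f : Space3 → ℂ} {fn : ℕ → Space3 → ℂ} {p : ENNReal}

theorem exists_seq_tendsto_ae_of_eLpNorm (hp : p ≠ 0) (hfn : ∀ n, AEStronglyMeasurable (fn n) volume)
    (hf : AEStronglyMeasurable f volume)
    (h : Tendsto (fun n => eLpNorm (fn n - f) p volume) atTop (𝓝 0)) :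
    ∃ ns : ℕ → ℕ, StrictMono ns ∧
      ∀ᵐ z, Tendsto (fun i => fn (ns i) z) atTop (𝓝 (f z)) :=
  (tendstoInMeasure_of_tendsto_eLpNorm hp hfn hf h).exists_seq_tendsto_ae

/-- A subsequence converges almost everywhere, and the pointwise limit of the radial profiles serves
as profile; `IsRadial` demands no measurability of it. -/
theorem isRadial_of_tendsto (hp : p ≠ 0) (hfn : ∀ n, AEStronglyMeasurable (fn n) volume)
    (hf : AEStronglyMeasurable f volume)
    (h : Tendsto (fun n => eLpNorm (fn n - f) p volume) atTop (𝓝 0)) (hr : ∀ n, IsRadial (fn n)) :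
    IsRadial f := by
  obtain ⟨ns, -, hns⟩ := exists_seq_tendsto_ae_of_eLpNorm hp hfn hf h
  choose k hk using hr
  refine ⟨fun r => limUnder atTop fun i => k (ns i) r, ?_⟩
  filter_upwards [hns, ae_all_iff.2 hk] with z hz hkz
  simp only [hkz] at hz
  exact hz.limUnder_eq.symm

theorem ae_eq_zero_of_tendsto (hp : p ≠ 0) (hfn : ∀ n, AEStronglyMeasurable (fn n) volume)
    (hf : AEStronglyMeasurable f volume)
    (h : Tendsto (fun n => eLpNorm (fn n - f) p volume) atTop (𝓝 0)) {R : ℝ} {δ : ℕ → ℝ}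
    (hδ : Tendsto δ atTop (𝓝 0)) (h0 : ∀ n z, R + δ n < ‖z‖ → fn n z = 0) :
    ∀ᵐ z, R < ‖z‖ → f z = 0 := by
  obtain ⟨ns, hmono, hns⟩ := exists_seq_tendsto_ae_of_eLpNorm hp hfn hf h
  filter_upwards [hns] with z hz hRz
  refine tendsto_nhds_unique hz (tendsto_const_nhds.congr' ?_)
  have h1 : Tendsto (fun i => R + δ (ns i)) atTop (𝓝 R) := by
    simpa using (hδ.comp hmono.tendsto_atTop).const_add R
  filter_upwards [h1.eventually_lt_const hRz] with i hi
  exact (h0 _ _ hi).symm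

theorem tendsto_integral_mul (hp : 1 ≤ p) (hfn : ∀ n, MemLp (fn n) p volume)
    (hf : MemLp f p volume) (h : Tendsto (fun n => eLpNorm (fn n - f) p volume) atTop (𝓝 0))
    {χ : Space3 → ℂ} (hχ : Continuous χ) (hχc : HasCompactSupport χ) :
    Tendsto (fun n => ∫ z, fn n z * χ z) atTop (𝓝 (∫ z, f z * χ z)) := by
  set q := ENNReal.conjExponent p with hq
  have hconj : ENNReal.HolderConjugate p q := ENNReal.HolderConjugate.conjExponent hp
  have hχq : MemLp χ q volume := hχ.memLp_of_hasCompactSupport hχc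
  have hi : ∀ {g : Space3 → ℂ}, MemLp g p volume → Integrable (fun z => g z * χ z) := fun hg =>
    (hg.locallyIntegrable hp).integrable_smul_right_of_hasCompactSupport hχ hχc
  refine tendsto_iff_edist_tendsto_0.2 ?_
  have hle : ∀ n, edist (∫ z, fn n z * χ z) (∫ z, f z * χ z) ≤
      eLpNorm (fn n - f) p volume * eLpNorm χ q volume := by
    intro n
    rw [edist_eq_enorm_sub, ← integral_sub (hi (hfn n)) (hi hf)]
    have e : (fun z => fn n z * χ z - f z * χ z) = (fn n - f) • χ := by
      funext z
      simp [sub_mul]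
    rw [e]
    refine (enorm_integral_le_lintegral_enorm _).trans ?_
    rw [← eLpNorm_one_eq_lintegral_enorm]
    exact eLpNorm_smul_le_mul_eLpNorm (p := p) (q := q) hχq.aestronglyMeasurable
      ((hfn n).sub hf).aestronglyMeasurable
  refine tendsto_of_tendsto_of_tendsto_of_le_of_le tendsto_const_nhds ?_ (fun n => zero_le) hle
  simpa using ENNReal.Tendsto.mul_const h (Or.inr hχq.eLpNorm_ne_top)

theorem IsTestFunction.integral_mul_gradient3 (hf : IsTestFunction f) {χ : Space3 → ℂ}
    (hχ : IsTestFunction χ) (i : Fin 3) :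
    ∫ z, f z * gradient3 χ z i = - ∫ z, gradient3 f z i * χ z :=
  integral_mul_pd hf.1 hχ.1 hf.2 (basisVec i)

theorem IsTestFunction.memLp (hf : IsTestFunction f) (p : ENNReal) : MemLp f p volume :=
  hf.1.continuous.memLp_of_hasCompactSupport hf.2

/-- Both sides of the integration by parts for `fn n` converge by Hölder's inequality. -/
theorem hasWeakGradient_of_tendsto {g : Space3 → EuclideanSpace ℂ (Fin 3)}
    (hfn : ∀ n, IsTestFunction (fn n)) (hf : MemLp f 6 volume) (hg : MemLp g 2 volume)
    (h6 : Tendsto (fun n => eLpNorm (fn n - f) 6 volume) atTop (𝓝 0))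
    (h2 : Tendsto (fun n => eLpNorm (gradient3 (fn n) - g) 2 volume) atTop (𝓝 0)) :
    HasWeakGradient f g where
  locallyIntegrable := hf.locallyIntegrable (by norm_num)
  locallyIntegrable_grad := hg.locallyIntegrable (by norm_num)
  integral_eq χ hχ i := by
    have hcoord : ∀ {k : Space3 → EuclideanSpace ℂ (Fin 3)}, MemLp k 2 volume →
        MemLp (fun z => k z i) 2 volume := fun hk =>
      hk.of_le ((EuclideanSpace.proj i).continuous.comp_aestronglyMeasurable
        hk.aestronglyMeasurable) (Eventually.of_forall fun z => PiLp.norm_apply_le _ i)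
    have h2i : Tendsto (fun n => eLpNorm ((fun z => gradient3 (fn n) z i) - fun z => g z i) 2 volume)
        atTop (𝓝 0) := by
      refine tendsto_of_tendsto_of_tendsto_of_le_of_le tendsto_const_nhds h2 (fun n => zero_le)
        fun n => eLpNorm_mono fun z => ?_
      exact PiLp.norm_apply_le (gradient3 (fn n) z - g z) i
    have l1 := tendsto_integral_mul (by norm_num) (fun n => (hfn n).memLp 6) hf h6
      (hχ.1.pd (basisVec i)).continuous (hχ.2.pd (basisVec i))
    have l2 := tendsto_integral_mul (by norm_num) (fun n => hcoord
      ((hfn n).continuous_gradient3.memLp_of_hasCompactSupport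
        (hfn n).hasCompactSupport_gradient3)) (hcoord hg) h2i hχ.1.continuous hχ.2
    refine tendsto_nhds_unique l1 (l2.neg.congr fun n => ?_)
    exact ((hfn n).integral_mul_gradient3 hχ i).symm

/-- The Sobolev inequality `‖f‖_{L⁶} ≤ C ‖∇f‖_{L²}` in `ℝ³`. -/
theorem exists_sobolev_const : ∃ C : NNReal, ∀ f : Space3 → ℂ, IsTestFunction f →
    eLpNorm f 6 volume ≤ C * eLpNorm (gradient3 f) 2 volume := by
  refine ⟨SNormLESNormFDerivOfEqConst ℂ (volume : Measure Space3) 2 * 3, fun f hf => ?_⟩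
  have h := eLpNorm_le_eLpNorm_fderiv_of_eq (volume : Measure Space3) (u := f) (p := 2) (p' := 6)
    (hf.1.of_le (by exact_mod_cast le_top)) hf.2 (by norm_num) (by simp) (by norm_num)
  have h3 : eLpNorm (fderiv ℝ f) (2 : NNReal) volume ≤ 3 * eLpNorm (gradient3 f) 2 volume := by
    -- The factor `3` comes from summing over the three coordinates.
    have hb : ∀ z, ‖fderiv ℝ f z‖ ≤ 3 * ‖gradient3 f z‖ := by
      intro z
      refine ContinuousLinearMap.opNorm_le_bound _ (by positivity) fun y => ?_
      rw [fderiv_apply_eq_sum]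
      refine (norm_sum_le _ _).trans ?_
      calc ∑ i, ‖(y i : ℂ) * pd (basisVec i) f z‖ ≤ ∑ _i : Fin 3, ‖gradient3 f z‖ * ‖y‖ := by
            refine Finset.sum_le_sum fun i _ => ?_
            rw [norm_mul, mul_comm, Complex.norm_real]
            exact mul_le_mul (PiLp.norm_apply_le (gradient3 f z) i) (PiLp.norm_apply_le y i)
              (norm_nonneg _) (norm_nonneg _)
        _ = 3 * ‖gradient3 f z‖ * ‖y‖ := by simp; ring
    have := eLpNorm_le_mul_eLpNorm_of_ae_le_mul (p := 2) (μ := volume)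
      (Eventually.of_forall hb)
    simpa using this
  refine h.trans ((mul_le_mul_right h3 _).trans ?_)
  rw [← mul_assoc]
  push_cast
  exact le_rfl

/-- The first projection pushes the cylinder measure to Lebesgue measure times the area of the
sphere. -/
theorem eLpNorm_comp_fst_cylinder {k : ℝ → ℂ} (hk : AEStronglyMeasurable k volume) :
    eLpNorm (fun p : ℝ × Sphere2 => k p.1) 2 cylinderMeasure =
      surf Set.univ ^ (1 / 2 : ℝ) * eLpNorm k 2 volume := by
  have hm : Measure.map Prod.fst cylinderMeasure = surf Set.univ • (volume : Measure ℝ) := by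
    rw [cylinderMeasure, Measure.map_fst_prod]
  have h := eLpNorm_map_measure (p := 2) (f := (Prod.fst : ℝ × Sphere2 → ℝ)) (g := k)
    (μ := cylinderMeasure) (by rw [hm]; exact hk.smul_measure _) measurable_fst.aemeasurable
  rw [hm, eLpNorm_smul_measure_of_ne_top (by norm_num)] at h
  rw [show (fun p : ℝ × Sphere2 => k p.1) = k ∘ Prod.fst from rfl, ← h]
  simp

end Limits

/-! ### Existence of radial data. -/

section Existence

theorem exists_limit_of_geometric {α E : Type*} [MeasurableSpace α] [NormedAddCommGroup E]
    [CompleteSpace E] {μ : Measure α} {p : ENNReal} (hp : 1 ≤ p) {f : ℕ → α → E}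
    (hf : ∀ n, MemLp (f n) p μ) {D : ENNReal} (hD : D ≠ ⊤)
    (h : ∀ N n m, N ≤ n → N ≤ m → eLpNorm (fun x => f n x - f m x) p μ ≤ D * 2⁻¹ ^ N) :
    ∃ g, MemLp g p μ ∧ Tendsto (fun n => eLpNorm (f n - g) p μ) atTop (𝓝 0) := by
  -- The completeness theorem wants strict bounds with a finite sum, whence `D + 1`.
  refine Lp.cauchy_complete_eLpNorm hp hf (B := fun N => (D + 1) * 2⁻¹ ^ N) ?_ fun N n m hn hm => ?_
  · rw [ENNReal.tsum_mul_left, ENNReal.tsum_geometric]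
    exact ENNReal.mul_ne_top (ENNReal.add_ne_top.2 ⟨hD, ENNReal.one_ne_top⟩) (by simp)
  · refine (h N n m hn hm).trans_lt ?_
    have h0 : (2⁻¹ : ENNReal) ^ N ≠ 0 := by simp
    have ht : (2⁻¹ : ENNReal) ^ N ≠ ⊤ := ENNReal.pow_ne_top (by simp)
    exact (ENNReal.mul_lt_mul_iff_left h0 ht).2 (ENNReal.lt_add_right hD one_ne_zero)

/-- The approximations have mean zero and live in `|s| ≤ R + 1/(n+1)`. Their explicit data converge
in energy, and radiality and support pass to the limit. -/
theorem exists_isRadiationField {F : ℝ → ℂ} (hF : MemLp F 2 volume) {R : ℝ} (hR : 0 ≤ R)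
    (hsupp : ∀ᵐ s : ℝ, R < |s| → F s = 0) (hmean : ∫ s, F s = 0) :
    ∃ φ ψ : Space3 → ℂ, IsRadiationField φ ψ (fun p => F p.1) ∧ IsRadial φ ∧ IsRadial ψ ∧
      (∀ᵐ z : Space3, R < ‖z‖ → φ z = 0) ∧ ∀ᵐ z : Space3, R < ‖z‖ → ψ z = 0 := by
  have happrox : ∀ n : ℕ, ∃ H : ℝ → ℂ, ContDiff ℝ ∞ H ∧
      (∀ s, R + 1 / ((n : ℝ) + 1) < |s| → H s = 0) ∧ ∫ s, H s = 0 ∧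
      eLpNorm (fun s => H s - F s) 2 volume ≤ 2⁻¹ ^ n := fun n =>
    exists_smooth_approx hF hR (by positivity) hsupp hmean (by simp [pos_iff_ne_zero])
  choose H hHs hH0 hHm hHF using happrox
  choose φn ψn hφn hψn hrad rφ rψ zφ zψ using fun n => exists_radial_data (hHs n) (hH0 n) (hHm n)
  have hHc : ∀ n, AEStronglyMeasurable (H n) volume := fun n => (hHs n).continuous.aestronglyMeasurable
  set c : ENNReal := surf Set.univ ^ (1 / 2 : ℝ) with hc
  have hct : c ≠ ⊤ := ENNReal.rpow_ne_top_of_nonneg (by norm_num) (measure_ne_top _ _)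
  have hgeo : ∀ N n m, N ≤ n → N ≤ m →
      2 * eLpNorm (fun p : ℝ × Sphere2 => H n p.1 - H m p.1) 2 cylinderMeasure ≤
        (4 * c) * 2⁻¹ ^ N := by
    intro N n m hn hm
    have hle : eLpNorm (fun s => H n s - H m s) 2 volume ≤ 2 * 2⁻¹ ^ N := by
      have e : (fun s => H n s - H m s) = (fun s => H n s - F s) - fun s => H m s - F s := by
        funext s
        simp
      rw [e]
      refine (eLpNorm_sub_le ((hHc n).sub hF.aestronglyMeasurable)
        ((hHc m).sub hF.aestronglyMeasurable) (by norm_num)).trans ?_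
      rw [two_mul]
      have hanti : ∀ k, N ≤ k → (2⁻¹ : ENNReal) ^ k ≤ 2⁻¹ ^ N := fun k hk =>
        pow_le_pow_right_of_le_one' (by simp) hk
      exact add_le_add ((hHF n).trans (hanti n hn)) ((hHF m).trans (hanti m hm))
    rw [eLpNorm_comp_fst_cylinder (k := fun s => H n s - H m s) ((hHc n).sub (hHc m)), ← hc]
    calc 2 * (c * eLpNorm (fun s => H n s - H m s) 2 volume) ≤ 2 * (c * (2 * 2⁻¹ ^ N)) := by
          gcongr
      _ = (4 * c) * 2⁻¹ ^ N := by ring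
  -- The energy bound transfers the Cauchy property from the fields to gradients and velocities.
  have hbd := fun n m => ((hrad n).sub (hrad m)).eLpNorm_le ((hφn n).sub (hφn m))
    ((hψn n).sub (hψn m))
  have h4c : 4 * c ≠ ⊤ := ENNReal.mul_ne_top (by norm_num) hct
  obtain ⟨ψ, hψ2, hψl⟩ := exists_limit_of_geometric (p := 2) (by norm_num)
    (fun n => (hψn n).memLp 2) h4c fun N n m hn hm => ((hbd n m).2).trans (hgeo N n m hn hm)
  have hgrad : ∀ N n m, N ≤ n → N ≤ m → eLpNorm (gradient3 fun z => φn n z - φn m z) 2 volume ≤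
      (4 * c) * 2⁻¹ ^ N := fun N n m hn hm => ((hbd n m).1).trans (hgeo N n m hn hm)
  obtain ⟨g, hg2, hgl⟩ := exists_limit_of_geometric (p := 2) (by norm_num)
    (fun n => (hφn n).continuous_gradient3.memLp_of_hasCompactSupport (μ := volume)
      (hφn n).hasCompactSupport_gradient3) h4c fun N n m hn hm => by
        rw [← gradient3_sub (hφn n) (hφn m)]
        exact hgrad N n m hn hm
  obtain ⟨C, hC⟩ := exists_sobolev_const
  obtain ⟨φ, hφ6, hφl⟩ := exists_limit_of_geometric (p := 6) (by norm_num)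
    (fun n => (hφn n).memLp 6) (ENNReal.mul_ne_top (ENNReal.coe_ne_top (r := C)) h4c)
    fun N n m hn hm => by
      refine (hC _ ((hφn n).sub (hφn m))).trans ?_
      rw [mul_assoc]
      gcongr
      exact hgrad N n m hn hm
  have hweak := hasWeakGradient_of_tendsto hφn hφ6 hg2 hφl hgl
  have mφ := fun n => (hφn n).1.continuous.aestronglyMeasurable (μ := volume)
  have mψ := fun n => (hψn n).1.continuous.aestronglyMeasurable (μ := volume)
  have hδ : Tendsto (fun n : ℕ => 1 / ((n : ℝ) + 1)) atTop (𝓝 0) :=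
    tendsto_one_div_add_atTop_nhds_zero_nat
  refine ⟨φ, ψ, ⟨⟨⟨hφ6, g, hweak, hg2⟩, hψ2⟩, hF.comp_fst _, φn, ψn, fun n p => H n p.1,
    fun n => ⟨hφn n, hψn n⟩, ⟨⟨g, hweak, hg2, hgl⟩, hψl⟩, hrad, ?_⟩,
    isRadial_of_tendsto (by norm_num) mφ hφ6.aestronglyMeasurable hφl rφ,
    isRadial_of_tendsto (by norm_num) mψ hψ2.aestronglyMeasurable hψl rψ,
    ae_eq_zero_of_tendsto (by norm_num) mφ hφ6.aestronglyMeasurable hφl hδ zφ,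
    ae_eq_zero_of_tendsto (by norm_num) mψ hψ2.aestronglyMeasurable hψl hδ zψ⟩
  have hlim : Tendsto (fun n : ℕ => c * (2⁻¹ : ENNReal) ^ n) atTop (𝓝 0) := by
    simpa using ENNReal.Tendsto.const_mul (ENNReal.tendsto_pow_atTop_nhds_zero_of_lt_one
      (r := 2⁻¹) (by simp)) (Or.inr hct)
  refine tendsto_of_tendsto_of_tendsto_of_le_of_le tendsto_const_nhds hlim (fun n => zero_le)
    fun n => ?_
  rw [eLpNorm_comp_fst_cylinder (k := fun s => H n s - F s)
    ((hHc n).sub hF.aestronglyMeasurable)]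
  exact mul_le_mul_right (hHF n) _

theorem IsRadial.congr {f f' : Space3 → ℂ} (h : IsRadial f') (hf : f =ᵐ[volume] f') :
    IsRadial f := by
  obtain ⟨k, hk⟩ := h
  refine ⟨k, ?_⟩
  filter_upwards [hk, hf] with z h1 h2
  rw [h2, h1]

end Existence

/-! ### Conclusion. -/

theorem mainTheorem11 (F : ℝ → ℂ) (hF : MemLp F 2 volume) (R : ℝ)
    (hsupp : ∀ᵐ s : ℝ, R < |s| → F s = 0) (hmean : ∫ s : ℝ, F s = 0) :
    (∃ φ ψ : Space3 → ℂ, IsRadiationField φ ψ (fun p => F p.1)) ∧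
    ∀ φ ψ : Space3 → ℂ, IsRadiationField φ ψ (fun p => F p.1) →
      IsRadial φ ∧ IsRadial ψ ∧ FiniteEnergy φ ψ ∧
      (∀ᵐ z : Space3, R ≤ ‖z‖ → φ z = 0) ∧ (∀ᵐ z : Space3, R ≤ ‖z‖ → ψ z = 0) := by
  -- The construction needs a nonnegative radius, whereas `R` may be negative.
  obtain ⟨φ₀, ψ₀, h₀, rφ, rψ, zφ, zψ⟩ := exists_isRadiationField hF (le_max_right R 0)
    (hsupp.mono fun s hs h => hs (lt_of_le_of_lt (le_max_left _ _) h)) hmean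
  refine ⟨⟨φ₀, ψ₀, h₀⟩, fun φ ψ h => ?_⟩
  obtain ⟨eφ, eψ⟩ := h.ae_unique h₀
  -- The bounding sphere is null, which upgrades vanishing outside the closed ball to `R ≤ ‖z‖`.
  have hsphere : ∀ᵐ z : Space3, ‖z‖ ≠ max R 0 := by
    have h0 := Measure.addHaar_sphere (volume : Measure Space3) 0 (max R 0)
    rw [ae_iff]
    convert h0 using 2
    ext z
    simp
  have hlt : ∀ z : Space3, ‖z‖ ≠ max R 0 → R ≤ ‖z‖ → max R 0 < ‖z‖ := fun z hz hR =>
    lt_of_le_of_ne (max_le hR (norm_nonneg z)) hz.symm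
  refine ⟨rφ.congr eφ, rψ.congr eψ, h.1, ?_, ?_⟩
  · filter_upwards [hsphere, zφ, eφ] with z h1 h2 h3 hR
    rw [h3, h2 (hlt z h1 hR)]
  · filter_upwards [hsphere, zψ, eψ] with z h1 h2 h3 hR
    rw [h3, h2 (hlt z h1 hR)]
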